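/- Let $\mathbb T=\mathbb R/\mathbb Z$ and $\mathbb T^2=\mathbb R^2/\mathbb Z^2$. For a Riemannian metric $g$ on $\mathbb T^2$ and $(m,n)\in\mathbb Z^2\cong H_1(\mathbb T^2,\mathbb Z)$, let $\mathcal L^{m,n}(\mathbb T^2,g)\subset(0,\infty)$ be the set of $g$-lengths of all (nonconstant, not necessarily primitive) closed geodesics in the homology class $(m,n)$, and put $$\mathcal L^{\mathrm{osc}}(\mathbb T^2,g)=\bigcup_{mn=0}\mathcal L^{m,n}(\mathbb T^2,g),\qquad \mathcal L_{\min}(\mathbb T^2,g)=\bigcup_{mn\neq0}\{\min\mathcal L^{m,n}(\mathbb T^2,g)\}.$$ For $0\le T<\infty$ (resp. $T=\infty$), $g$ satisfies the noncoincidence condition (NCC) up to $T$ if $\mathcal L_{\min}(\mathbb T^2,g)\cap\mathcal L^{\mathrm{osc}}(\mathbb T^2,g)\cap I=\varnothing$ with $I=[0,T]$ (resp. $I=[0,\infty)$). Let $r$ be an integer $\ge 2$, or $r=\infty$, or $r=\omega$ (real-analytic). Endow $C^r(\mathbb T)$ with its usual topology: uniform convergence of all derivatives of order $\le r$ if $r\ne\omega$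 (of all orders if $r=\infty$), and, if $r=\omega$, the locally convex inductive limit topology of the Banach spaces of functions having a bounded holomorphic extension to $\{|\operatorname{Im}z|<\rho\}$, $\rho>0$, with the supremum norm. Let $\mathcal P^r$ be the set of pairs $(f_1,f_2)\in C^r(\mathbb T)\times C^r(\mathbb T)$ such that $f_1(x_1)+f_2(x_2)>-1$ for all $x_1,x_2$, with the topology induced from the product, and for $(f_1,f_2)\in\mathcal P^r$ consider the Liouville metric $$g_{f_1,f_2}=\bigl(1+f_1(x_1)+f_2(x_2)\bigr)\,(\mathrm dx_1^2+\mathrm dx_2^2)$$ on $\mathbb T^2$. **Proposition.** (i) The set of $(f_1,f_2)\in\mathcal P^r$ for which $g_{f_1,f_2}$ satisfies NCC up to $T=\infty$ is generic in $\mathcal P^r$, i.e. it contains a countable intersection of open dense subsets of $\mathcal P^r$. (ii) For every finite $T\ge0$, the set of $(f_1,f_2)\in\mathcal P^r$ for which $g_{f_1,f_2}$ satisfies NCC up to $T$ is open and dense in $\mathcal P^r$. -/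

import Mathlib

open scoped ContDiff UniformConvergence Topology

noncomputable section

/-! ### Riemannian metrics on the torus `ℝ²/ℤ²`, closed geodesics, length spectra -/

/-- A `C²` Riemannian metric on the torus `ℝ²/ℤ²`, given by its coefficients `g_{ij}` on the
universal cover `ℝ²`. -/
structure TorusMetric where
  coeff : (Fin 2 → ℝ) → Matrix (Fin 2) (Fin 2) ℝ
  contDiff_coeff : ∀ i j, ContDiff ℝ 2 fun x => coeff x i j
  posDef_coeff : ∀ x, (coeff x).PosDef
  periodic_coeff : ∀ (x : Fin 2 → ℝ) (k : Fin 2 → ℤ), coeff (x + fun i => (k i : ℝ)) = coeff x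

namespace TorusMetric

/-- The squared length `g_x(v, v)`. -/
def normSq (g : TorusMetric) (x v : Fin 2 → ℝ) : ℝ :=
  ∑ i, ∑ j, g.coeff x i j * v i * v j

/-- The partial derivative `∂_k g_{ij}` at `x`. -/
def partialCoeff (g : TorusMetric) (k i j : Fin 2) (x : Fin 2 → ℝ) : ℝ :=
  fderiv ℝ (fun y => g.coeff y i j) x (Pi.single k 1)

/-- `γ` is (the lift to `ℝ²` of) a unit-speed geodesic defined for all times. The last condition
is the geodesic equation in Euler–Lagrange form,
`d/dt (∑ⱼ g_{kj}(γ) γ'ⱼ) = ½ ∑_{i,j} ∂_k g_{ij}(γ) γ'ᵢ γ'ⱼ`. -/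
structure IsUnitSpeedGeodesic (g : TorusMetric) (γ : ℝ → Fin 2 → ℝ) : Prop where
  contDiff : ContDiff ℝ 2 γ
  unit_speed : ∀ t, g.normSq (γ t) (deriv γ t) = 1
  geodesic_eq : ∀ t k,
    deriv (fun s => ∑ j, g.coeff (γ s) k j * deriv γ s j) t =
      (1 / 2) * ∑ i, ∑ j, g.partialCoeff k i j (γ t) * deriv γ t i * deriv γ t j

/-- The Riemannian length of `γ` restricted to `[0, P]`. -/
def arcLength (g : TorusMetric) (γ : ℝ → Fin 2 → ℝ) (P : ℝ) : ℝ :=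
  ∫ t in (0 : ℝ)..P, Real.sqrt (g.normSq (γ t) (deriv γ t))

/-- The `(m,n)`-length spectrum: lengths of all (not necessarily primitive) closed geodesics in
the homology class `(m,n) ∈ ℤ² ≅ H₁(ℝ²/ℤ², ℤ)`. A closed geodesic with period `P` lies in the class
`(m,n)` when its lifts satisfy `γ(t + P) = γ(t) + (m,n)`. -/
def lengthSpectrum (g : TorusMetric) (m n : ℤ) : Set ℝ :=
  {ℓ | ∃ (γ : ℝ → Fin 2 → ℝ) (P : ℝ), 0 < P ∧ g.IsUnitSpeedGeodesic γ ∧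
    (∀ t, γ (t + P) = γ t + ![(m : ℝ), (n : ℝ)]) ∧ ℓ = g.arcLength γ P}

/-- The oscillatory length spectrum: the union of the `(m,n)`-length spectra over `mn = 0`. -/
def oscLengthSpectrum (g : TorusMetric) : Set ℝ :=
  {ℓ | ∃ m n : ℤ, m * n = 0 ∧ ℓ ∈ g.lengthSpectrum m n}

/-- The minimal length spectrum: the minima of the `(m,n)`-length spectra over `mn ≠ 0`. -/
def minLengthSpectrum (g : TorusMetric) : Set ℝ :=
  {ℓ | ∃ m n : ℤ, m * n ≠ 0 ∧ IsLeast (g.lengthSpectrum m n) ℓ}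

/-- The noncoincidence condition on `I`. -/
def NCC (g : TorusMetric) (I : Set ℝ) : Prop :=
  g.minLengthSpectrum ∩ g.oscLengthSpectrum ∩ I = ∅

end TorusMetric

/-! ### Spaces of functions on the circle `ℝ/ℤ` -/

/-- The `1`-periodic functions `ℝ → ℝ` of class `C^r`, where `r` is a natural number, `∞`, or `ω`
(real-analytic). -/
def circleFunSubmodule (r : WithTop ℕ∞) : Submodule ℝ (ℝ → ℝ) where
  carrier := {f | ContDiff ℝ r f ∧ Function.Periodic f 1}
  add_mem' := fun ha hb => ⟨ha.1.add hb.1, ha.2.add hb.2⟩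
  zero_mem' := ⟨contDiff_const, fun _ => rfl⟩
  smul_mem' := fun c _ hf => ⟨hf.1.const_smul c, fun x => congrArg (c • ·) (hf.2 x)⟩

/-- The space `C^r(ℝ/ℤ)`. It is not reducible to a subtype of `ℝ → ℝ`, so that it does not
inherit the topology of pointwise convergence. -/
def CircleFun (r : WithTop ℕ∞) : Type := circleFunSubmodule r

namespace CircleFun

variable {r : WithTop ℕ∞}

instance : AddCommGroup (CircleFun r) := inferInstanceAs (AddCommGroup (circleFunSubmodule r))

instance : Module ℝ (CircleFun r) := inferInstanceAs (Module ℝ (circleFunSubmodule r))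

instance : CoeFun (CircleFun r) (fun _ => ℝ → ℝ) := ⟨fun f => f.1⟩

/-- The `C^r` topology: uniform convergence of all derivatives of order `k ≤ r` (of all
orders if `r = ∞`). -/
@[reducible]
def crTopology (r : WithTop ℕ∞) : TopologicalSpace (CircleFun r) :=
  ⨅ (k : ℕ) (_ : (k : WithTop ℕ∞) ≤ r),
    TopologicalSpace.induced (fun f : CircleFun r => UniformFun.ofFun (iteratedDeriv k f))
      (inferInstance : TopologicalSpace (ℝ →ᵤ ℝ))

/-- `f` lies in the closed ball of radius `C` of the Banach space `A_ρ` of functions with a bounded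
holomorphic extension to the strip `|Im z| < ρ`, with the supremum norm. -/
def InStripBall (ρ C : ℝ) (f : CircleFun ω) : Prop :=
  ∃ F : ℂ → ℂ, DifferentiableOn ℂ F {z | |z.im| < ρ} ∧ (∀ x : ℝ, F x = (f x : ℂ)) ∧
    ∀ z : ℂ, |z.im| < ρ → ‖F z‖ ≤ C

/-- The usual topology of `C^ω(ℝ/ℤ) = ⋃_{ρ > 0} A_ρ`, the locally convex inductive limit: the finest
locally convex vector space topology for which every inclusion `A_ρ → C^ω(ℝ/ℤ)` is continuous
(equivalently, the inclusions being linear, continuous at `0`). In Mathlib's order on topologies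
the finest one is the infimum. -/
@[reducible]
def analyticTopology : TopologicalSpace (CircleFun ω) :=
  sInf {t | @IsTopologicalAddGroup (CircleFun ω) t _ ∧ @ContinuousSMul ℝ (CircleFun ω) _ _ t ∧
    @LocallyConvexSpace ℝ (CircleFun ω) _ _ _ _ t ∧
    ∀ ρ : ℝ, 0 < ρ → ∀ U ∈ @nhds (CircleFun ω) t 0,
      ∃ δ : ℝ, 0 < δ ∧ ∀ f, InStripBall ρ δ f → f ∈ U}

instance : TopologicalSpace (CircleFun r) :=
  match r with
  | ⊤ => analyticTopology
  | (k : ℕ∞) => crTopology k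

end CircleFun

/-! ### Liouville metrics -/

/-- The Liouville metric `(1 + f₁(x₁) + f₂(x₂)) (dx₁² + dx₂²)`. -/
def liouvilleMetric (f₁ f₂ : ℝ → ℝ) (h₁ : ContDiff ℝ 2 f₁) (h₂ : ContDiff ℝ 2 f₂)
    (p₁ : Function.Periodic f₁ 1) (p₂ : Function.Periodic f₂ 1)
    (hpos : ∀ x₁ x₂, -1 < f₁ x₁ + f₂ x₂) : TorusMetric where
  coeff x := Matrix.diagonal fun _ => 1 + f₁ (x 0) + f₂ (x 1)
  contDiff_coeff i j := by
    have h : ContDiff ℝ 2 fun x : Fin 2 → ℝ => 1 + f₁ (x 0) + f₂ (x 1) :=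
      (contDiff_const.add (h₁.comp (contDiff_apply ℝ ℝ 0))).add
        (h₂.comp (contDiff_apply ℝ ℝ 1))
    by_cases hij : i = j
    · subst hij
      simpa using h
    · simpa [Matrix.diagonal_apply_ne _ hij] using contDiff_const
  posDef_coeff x := Matrix.PosDef.diagonal fun _ => by linarith [hpos (x 0) (x 1)]
  periodic_coeff x k := by
    have e₁ : f₁ (x 0 + (k 0 : ℝ)) = f₁ (x 0) := by simpa using p₁.int_mul (k 0) (x 0)
    have e₂ : f₂ (x 1 + (k 1 : ℝ)) = f₂ (x 1) := by simpa using p₂.int_mul (k 1) (x 1)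
    simp [e₁, e₂]

/-- The pairs `(f₁, f₂)` of `C^r` functions on the circle with `f₁(x₁) + f₂(x₂) > -1`, with the
topology induced by the product topology. -/
abbrev LiouvillePair (r : WithTop ℕ∞) : Type :=
  {p : CircleFun r × CircleFun r // ∀ x₁ x₂ : ℝ, -1 < p.1 x₁ + p.2 x₂}

/-- The Liouville metric of a pair `(f₁, f₂)` of class `C^r`, `r ≥ 2`. -/
def LiouvillePair.metric {r : WithTop ℕ∞} (hr : 2 ≤ r) (p : LiouvillePair r) : TorusMetric :=
  liouvilleMetric p.1.1 p.1.2 (p.1.1.2.1.of_le hr) (p.1.2.2.1.of_le hr)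
    p.1.1.2.2 p.1.2.2.2 p.2

end

/-! Write V = u(x) + w(y) with u = 1 + f₁ and w = f₂. After the time change dτ = dt / V a unit-speed
geodesic splits into the Newton equations x'' = u'(x)/2 and y'' = w'(y)/2, with separate energies
x'² = u(x) - c and y'² = w(y) + c, and its length becomes the action ∫ (x'² + y'²) dτ
(`HamiltonOrbit.mem_separatedSpectrum`).

If mn ≠ 0, both coordinates rotate. The length is A(c) = |m| ∫ √(u - c) + |n| ∫ √(w + c), and
equality of the two periods says A'(c) = 0. Since A is concave, the class has at most one length, so
NCC up to T says that no class with mn ≠ 0 shares a length ≤ T with a class with mn = 0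
(`LiouvillePair.setOf_ncc_eq`).

If m = 0, then x has a turning point a and c = u(a) ≥ min u, whereas rotational levels lie strictly
below min u. Through this gap one perturbation acts on the two types differently: w_s = w + s(w -
μ), with μ the mean of w for the weight 1/√(w + e₀) and e₀ strictly between the rotational level and
min u. For small s the rotational length does not increase, while |n| ∫ √(w_s + u(a)) grows at a
positive rate uniform in a (`exists_weighted_mean`). The turning point may move with s, but closed
librations are critical points of the action, so this costs only a quadratic error
(`exists_action_variation`). If coincidences occurred for every small s, with turning points a(s) in
[0, 1], a pigeonhole argument would give s < s' with (a(s') - a(s))² negligible against s' - s, a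
contradiction (`exists_dilate_disjoint`). Nothing is assumed about how a(s) depends on s, so C²
regularity suffices.

For fixed T, each set of pairs with a given coincidence is closed by compactness of geodesics, and
these sets form a locally finite family because length controls |m| and |n|. A locally finite union
of closed sets with dense complements is closed with dense complement, which gives (ii);
intersecting over T ∈ ℕ gives (i). The topology of C^r enters only through uniform convergence of
derivatives up to order two and continuity of s ↦ f + s h. -/

noncomputable section

open Set Filter

/-! ### Bounds for periodic `C²` functions -/

/-- `u` is `C²`, and `u`, `u'`, `u''` are bounded by `K`. -/
structure C2Bound (u : ℝ → ℝ) (K : ℝ) : Prop where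
  contDiff : ContDiff ℝ 2 u
  abs_le : ∀ x, |u x| ≤ K
  abs_deriv_le : ∀ x, |deriv u x| ≤ K
  abs_deriv_deriv_le : ∀ x, |deriv (deriv u) x| ≤ K

theorem Function.Periodic.exists_abs_le {f : ℝ → ℝ} (hf : Continuous f) (hp : Function.Periodic f 1) :
    ∃ K, ∀ x, |f x| ≤ K := by
  obtain ⟨K, hK⟩ := (hp.isBounded_of_continuous one_ne_zero hf).exists_norm_le
  exact ⟨K, fun x => hK _ (mem_range_self x)⟩

theorem Function.Periodic.deriv_periodic {f : ℝ → ℝ} (hp : Function.Periodic f 1) :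
    Function.Periodic (deriv f) 1 := by
  intro x
  rw [← deriv_comp_add_const]
  congr 1
  funext y
  exact hp y

theorem exists_c2Bound {u : ℝ → ℝ} (hu : ContDiff ℝ 2 u) (hp : Function.Periodic u 1) :
    ∃ K, 0 < K ∧ C2Bound u K := by
  have h1 : ContDiff ℝ 1 (deriv u) := by
    have : ContDiff ℝ (1 + 1) u := by simpa [one_add_one_eq_two] using hu
    exact (contDiff_succ_iff_deriv.1 this).2.2
  have h2 : Continuous (deriv (deriv u)) := h1.continuous_deriv le_rfl
  obtain ⟨K0, h0⟩ := hp.exists_abs_le hu.continuous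
  obtain ⟨K1, h1⟩ := hp.deriv_periodic.exists_abs_le h1.continuous
  obtain ⟨K2, h2⟩ := hp.deriv_periodic.deriv_periodic.exists_abs_le h2
  refine ⟨max 1 (max K0 (max K1 K2)), by positivity, hu, fun x => ?_, fun x => ?_, fun x => ?_⟩
  · exact (h0 x).trans (by simp)
  · exact (h1 x).trans (by simp)
  · exact (h2 x).trans (by simp)

namespace C2Bound

variable {u : ℝ → ℝ} {K : ℝ}

theorem nonneg (h : C2Bound u K) : 0 ≤ K := (abs_nonneg _).trans (h.abs_le 0)

theorem contDiff_deriv (h : C2Bound u K) : ContDiff ℝ 1 (deriv u) := by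
  have : ContDiff ℝ (1 + 1) u := by simpa [one_add_one_eq_two] using h.contDiff
  exact (contDiff_succ_iff_deriv.1 this).2.2

theorem differentiable (h : C2Bound u K) : Differentiable ℝ u :=
  h.contDiff.differentiable (by norm_num)

theorem hasDerivAt (h : C2Bound u K) (x : ℝ) : HasDerivAt u (deriv u x) x :=
  (h.differentiable x).hasDerivAt

theorem abs_sub_le (h : C2Bound u K) (x y : ℝ) : |u x - u y| ≤ K * |x - y| := by
  have := Convex.norm_image_sub_le_of_norm_deriv_le (𝕜 := ℝ) (f := u) (C := K) (s := univ)
    (x := y) (y := x) (fun z _ => h.differentiable z) (fun z _ => h.abs_deriv_le z)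
    convex_univ (mem_univ _) (mem_univ _)
  simpa using this

theorem abs_deriv_sub_le (h : C2Bound u K) (x y : ℝ) : |deriv u x - deriv u y| ≤ K * |x - y| := by
  have := Convex.norm_image_sub_le_of_norm_deriv_le (𝕜 := ℝ) (f := deriv u) (C := K) (s := univ)
    (x := y) (y := x) (fun z _ => h.contDiff_deriv.differentiable (by norm_num) z)
    (fun z _ => h.abs_deriv_deriv_le z) convex_univ (mem_univ _) (mem_univ _)
  simpa using this

theorem abs_taylor_le (h : C2Bound u K) (x y : ℝ) :
    |u y - u x - deriv u x * (y - x)| ≤ K * (y - x) ^ 2 := by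
  have := Convex.norm_image_sub_le_of_norm_hasDerivWithin_le (𝕜 := ℝ)
    (f := fun z => u z - deriv u x * z) (f' := fun z => deriv u z - deriv u x)
    (C := K * |y - x|) (s := uIcc x y) (x := x) (y := y)
    (fun z _ => by
      simpa using ((h.hasDerivAt z).fun_sub ((hasDerivAt_id z).const_mul (deriv u x))).hasDerivWithinAt)
    (fun z hz => (h.abs_deriv_sub_le z x).trans
      (mul_le_mul_of_nonneg_left (abs_sub_left_of_mem_uIcc hz) h.nonneg))
    (convex_uIcc x y) left_mem_uIcc right_mem_uIcc
  have e : u y - u x - deriv u x * (y - x) = u y - deriv u x * y - (u x - deriv u x * x) := by ring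
  rw [e]
  refine this.trans (le_of_eq ?_)
  rw [Real.norm_eq_abs, mul_assoc, ← sq, sq_abs]

end C2Bound

/-! ### One-dimensional Newton equations -/

/-- `x` solves `x'' = u'(x) / 2`, with velocity `v`. -/
structure NewtonSolution (u x v : ℝ → ℝ) : Prop where
  hasDerivAt_pos : ∀ t, HasDerivAt x (v t) t
  hasDerivAt_vel : ∀ t, HasDerivAt v (deriv u (x t) / 2) t

namespace NewtonSolution

variable {u x v x₀ v₀ x₁ v₁ : ℝ → ℝ} {K : ℝ}

theorem continuous_pos (h : NewtonSolution u x v) : Continuous x :=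
  continuous_iff_continuousAt.2 fun t => (h.hasDerivAt_pos t).continuousAt

theorem continuous_vel (h : NewtonSolution u x v) : Continuous v :=
  continuous_iff_continuousAt.2 fun t => (h.hasDerivAt_vel t).continuousAt

theorem energy_eq (h : NewtonSolution u x v) (hu : C2Bound u K) (s t : ℝ) :
    v s ^ 2 - u (x s) = v t ^ 2 - u (x t) := by
  have hd : ∀ t, HasDerivAt (fun t => v t ^ 2 - u (x t)) 0 t := fun t => by
    refine (((h.hasDerivAt_vel t).fun_pow 2).fun_sub
      ((hu.hasDerivAt (x t)).comp t (h.hasDerivAt_pos t))).congr_deriv ?_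
    push_cast
    ring
  exact is_const_of_deriv_eq_zero (fun t => (hd t).differentiableAt) (fun t => (hd t).deriv) s t

theorem comp_add_const (h : NewtonSolution u x v) (a : ℝ) :
    NewtonSolution u (fun t => x (t + a)) (fun t => v (t + a)) :=
  ⟨fun t => (h.hasDerivAt_pos _).comp_add_const t a, fun t => (h.hasDerivAt_vel _).comp_add_const t a⟩

theorem comp_const_sub (h : NewtonSolution u x v) (a : ℝ) :
    NewtonSolution u (fun t => x (a - t)) (fun t => -v (a - t)) :=
  ⟨fun t => (h.hasDerivAt_pos _).comp_const_sub a t, fun t => by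
    simpa using ((h.hasDerivAt_vel _).comp_const_sub a t).fun_neg⟩

theorem add_int (h : NewtonSolution u x v) (hp : Function.Periodic u 1) (k : ℤ) :
    NewtonSolution u (fun t => x t + k) v := by
  refine ⟨fun t => (h.hasDerivAt_pos t).add_const _, fun t => ?_⟩
  have : deriv u (x t + k) = deriv u (x t) := by simpa using hp.deriv_periodic.int_mul k (x t)
  rw [this]
  exact h.hasDerivAt_vel t

theorem lipschitzWith_field (hu : C2Bound u K) :
    LipschitzWith (Real.toNNReal (max 1 K)) (fun q : ℝ × ℝ => (q.2, deriv u q.1 / 2)) := by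
  refine LipschitzWith.of_dist_le_mul fun p q => ?_
  rw [Real.coe_toNNReal _ (by positivity), Prod.dist_eq, Prod.dist_eq, max_le_iff]
  have h1 : dist p.1 q.1 ≤ max (dist p.1 q.1) (dist p.2 q.2) := le_max_left _ _
  have h2 : dist p.2 q.2 ≤ max (dist p.1 q.1) (dist p.2 q.2) := le_max_right _ _
  have h0 : 0 ≤ dist p.1 q.1 := dist_nonneg
  constructor
  · calc dist p.2 q.2 ≤ 1 * max (dist p.1 q.1) (dist p.2 q.2) := by simp
      _ ≤ _ := by gcongr; exact le_max_left _ _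
  · have h3 := hu.abs_deriv_sub_le p.1 q.1
    rw [← Real.dist_eq, ← Real.dist_eq] at h3
    calc dist (deriv u p.1 / 2) (deriv u q.1 / 2) = dist (deriv u p.1) (deriv u q.1) / 2 := by
          rw [Real.dist_eq, Real.dist_eq, ← sub_div, abs_div, abs_two]
      _ ≤ K * dist p.1 q.1 := by
          have : 0 ≤ dist (deriv u p.1) (deriv u q.1) := dist_nonneg
          linarith
      _ ≤ max 1 K * max (dist p.1 q.1) (dist p.2 q.2) := by gcongr; exact le_max_right _ _

theorem hasDerivAt_prod (h : NewtonSolution u x v) (t : ℝ) :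
    HasDerivAt (fun t => (x t, v t)) (v t, deriv u (x t) / 2) t :=
  (h.hasDerivAt_pos t).prodMk (h.hasDerivAt_vel t)

theorem eq_of_init_eq (hu : C2Bound u K) (h₀ : NewtonSolution u x₀ v₀) (h₁ : NewtonSolution u x₁ v₁)
    {t₀ : ℝ} (hx : x₀ t₀ = x₁ t₀) (hv : v₀ t₀ = v₁ t₀) (t : ℝ) : x₀ t = x₁ t := by
  have := ODE_solution_unique_univ (v := fun _ (q : ℝ × ℝ) => (q.2, deriv u q.1 / 2))
    (s := fun _ => univ) (K := Real.toNNReal (max 1 K)) (t₀ := t₀)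
    (fun _ => (lipschitzWith_field hu).lipschitzOnWith)
    (fun t => ⟨h₀.hasDerivAt_prod t, mem_univ _⟩) (fun t => ⟨h₁.hasDerivAt_prod t, mem_univ _⟩)
    (by simp [hx, hv])
  exact congrArg Prod.fst (congrFun this t)

/-- Lipschitz dependence of solutions starting at rest on the initial position. -/
theorem abs_sub_le (hu : C2Bound u K) (h₀ : NewtonSolution u x₀ v₀) (h₁ : NewtonSolution u x₁ v₁)
    (hv₀ : v₀ 0 = 0) (hv₁ : v₁ 0 = 0) {t R : ℝ} (ht : 0 ≤ t) (htR : t ≤ R) :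
    |x₁ t - x₀ t| ≤ |x₁ 0 - x₀ 0| * Real.exp (max 1 K * R) ∧
      |v₁ t - v₀ t| ≤ |x₁ 0 - x₀ 0| * Real.exp (max 1 K * R) := by
  have hd := dist_le_of_trajectories_ODE (v := fun _ (q : ℝ × ℝ) => (q.2, deriv u q.1 / 2))
    (K := Real.toNNReal (max 1 K)) (a := 0) (b := R) (δ := |x₁ 0 - x₀ 0|)
    (fun _ => lipschitzWith_field hu)
    (fun t _ => (h₁.hasDerivAt_prod t).continuousAt.continuousWithinAt)
    (fun t _ => (h₁.hasDerivAt_prod t).hasDerivWithinAt)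
    (fun t _ => (h₀.hasDerivAt_prod t).continuousAt.continuousWithinAt)
    (fun t _ => (h₀.hasDerivAt_prod t).hasDerivWithinAt)
    (by simp [Prod.dist_eq, hv₀, hv₁, Real.dist_eq]) t ⟨ht, htR⟩
  rw [Real.coe_toNNReal _ (by positivity), sub_zero, Prod.dist_eq, max_le_iff] at hd
  have hle : |x₁ 0 - x₀ 0| * Real.exp (max 1 K * t) ≤ |x₁ 0 - x₀ 0| * Real.exp (max 1 K * R) := by
    gcongr
  exact ⟨hd.1.trans hle, hd.2.trans hle⟩

/-- A solution which is at rest at some time has no drift. -/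
theorem drift_eq_zero (h : NewtonSolution u x v) (hu : C2Bound u K) {Q m : ℝ}
    (hm : ∀ t, x (t + Q) = x t + m) {t₀ : ℝ} (h0 : v t₀ = 0) : m = 0 := by
  -- By time reversal the orbit is symmetric about `t₀`, so `x (t₀ + Q) = x (t₀ - Q)`; the drift
  -- turns this into `x t₀ + m = x t₀ - m`.
  have := eq_of_init_eq hu h (h.comp_const_sub (2 * t₀)) (t₀ := t₀) (by ring_nf)
    (by rw [h0]; ring_nf; simp [h0]) (t₀ + Q)
  have e := hm (t₀ - Q)
  have e2 := hm t₀
  rw [show 2 * t₀ - (t₀ + Q) = t₀ - Q by ring] at this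
  rw [sub_add_cancel] at e
  linarith

theorem surjective_of_drift (h : NewtonSolution u x v) {Q : ℝ} {m : ℤ}
    (hm : ∀ t, x (t + Q) = x t + m) (hm0 : m ≠ 0) : Function.Surjective x := by
  have hk : ∀ k : ℤ, x (k * Q) = x 0 + k * m := by
    intro k
    induction k with
    | zero => simp
    | succ i ih => push_cast at ih ⊢; rw [add_mul, one_mul, hm, ih]; ring
    | pred i ih =>
      have := hm ((-(i : ℤ) - 1 : ℤ) * Q)
      push_cast at this ih ⊢
      rw [show (-(i : ℝ) - 1) * Q + Q = -i * Q by ring, ih] at this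
      linarith
  intro ξ
  have hm1 : (1 : ℝ) ≤ |(m : ℝ)| := by exact_mod_cast Int.one_le_abs hm0
  obtain ⟨N, hN⟩ := exists_nat_ge |ξ - x 0|
  have hup : ξ ≤ x ((N * m.sign : ℤ) * Q) := by
    rw [hk]
    push_cast
    have : (m.sign : ℝ) * m = |(m : ℝ)| := by exact_mod_cast Int.sign_mul_self_eq_abs m
    rw [mul_assoc, this]
    have := le_abs_self (ξ - x 0)
    have : (N : ℝ) * 1 ≤ N * |(m : ℝ)| := by gcongr
    linarith
  have hlo : x ((-(N * m.sign) : ℤ) * Q) ≤ ξ := by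
    rw [hk]
    push_cast
    have : (m.sign : ℝ) * m = |(m : ℝ)| := by exact_mod_cast Int.sign_mul_self_eq_abs m
    rw [neg_mul, mul_assoc, this]
    have := neg_abs_le (ξ - x 0)
    have : (N : ℝ) * 1 ≤ N * |(m : ℝ)| := by gcongr
    linarith
  exact mem_range_of_exists_le_of_exists_ge h.continuous_pos ⟨_, hlo⟩ ⟨_, hup⟩

/-- A solution with nonzero drift has its energy level below the minimum of `u`. -/
theorem level_lt_of_drift (h : NewtonSolution u x v) (hu : C2Bound u K) {Q c : ℝ} {m : ℤ}
    (hm : ∀ t, x (t + Q) = x t + m) (hm0 : m ≠ 0) (hc : ∀ t, v t ^ 2 = u (x t) - c) (ξ : ℝ) :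
    c < u ξ := by
  obtain ⟨t, rfl⟩ := h.surjective_of_drift hm hm0 ξ
  have hv : v t ≠ 0 := fun h0 => hm0 (by exact_mod_cast h.drift_eq_zero hu hm h0)
  have := hc t
  have := pow_pos (abs_pos.2 hv) 2
  rw [sq_abs] at this
  linarith

end NewtonSolution

/-! ### Action and period of rotations -/

/-- `∫₀¹ √h`. -/
def sqrtMean (h : ℝ → ℝ) : ℝ := ∫ x in (0 : ℝ)..1, √(h x)

/-- `∫₀¹ 1/√h`. -/
def invSqrtMean (h : ℝ → ℝ) : ℝ := ∫ x in (0 : ℝ)..1, (√(h x))⁻¹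

theorem Function.Periodic.integral_drift {f : ℝ → ℝ} (hf : Continuous f)
    (hp : Function.Periodic f 1) (a : ℝ) (m : ℤ) :
    ∫ x in a..(a + m), f x = m * ∫ x in (0 : ℝ)..1, f x := by
  have := hp.intervalIntegral_add_zsmul_eq m a (fun t s => hf.intervalIntegrable t s)
  have e := hp.intervalIntegral_add_eq a 0
  simp only [zsmul_eq_mul, mul_one, zero_add] at this e
  rw [this, e]

/-- Below the minimum of `u` the velocity never vanishes, so `x` is a legitimate variable of
integration: period and action become integrals of `1/√(u - c)` and `√(u - c)` over `|m|` circles.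
-/
theorem NewtonSolution.rotation {u x v : ℝ → ℝ} {K Q c : ℝ} {m : ℤ} (h : NewtonSolution u x v)
    (hu : C2Bound u K) (hp : Function.Periodic u 1) (hQ : 0 < Q)
    (hm : ∀ t, x (t + Q) = x t + m) (hc : ∀ t, v t ^ 2 = u (x t) - c) (hlt : ∀ ξ, c < u ξ) :
    m ≠ 0 ∧ Q = |(m : ℝ)| * invSqrtMean (fun ξ => u ξ - c) ∧
      ∫ t in (0 : ℝ)..Q, v t ^ 2 = |(m : ℝ)| * sqrtMean (fun ξ => u ξ - c) := by
  have hpos : ∀ ξ, 0 < √(u ξ - c) := fun ξ => Real.sqrt_pos.2 (by linarith [hlt ξ])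
  have hucont : Continuous u := hu.contDiff.continuous
  have hcs : Continuous fun ξ => √(u ξ - c) := (hucont.sub continuous_const).sqrt
  have hci : Continuous fun ξ => (√(u ξ - c))⁻¹ := hcs.inv₀ fun ξ => (hpos ξ).ne'
  have hps : Function.Periodic (fun ξ => √(u ξ - c)) 1 := fun ξ => by
    change √(u (ξ + 1) - c) = √(u ξ - c)
    rw [hp ξ]
  have hpi : Function.Periodic (fun ξ => (√(u ξ - c))⁻¹) 1 := fun ξ => by
    change (√(u (ξ + 1) - c))⁻¹ = (√(u ξ - c))⁻¹
    rw [hp ξ]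
  have habs : ∀ t, |v t| = √(u (x t) - c) := fun t => by rw [← hc, Real.sqrt_sq_eq_abs]
  have hv0 : ∀ t, v t ≠ 0 := fun t h0 => by
    have := habs t
    rw [h0, abs_zero] at this
    exact (hpos _).ne this
  -- The velocity has a constant sign `σ` by the intermediate value theorem.
  obtain ⟨σ, hσ, hvσ⟩ : ∃ σ : ℝ, (σ = 1 ∨ σ = -1) ∧ ∀ t, v t = σ * √(u (x t) - c) := by
    rcases lt_or_gt_of_ne (hv0 0) with h0 | h0
    · refine ⟨-1, Or.inr rfl, fun t => ?_⟩
      have : v t < 0 := by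
        by_contra hcon
        obtain ⟨s, hs⟩ := mem_range_of_exists_le_of_exists_ge h.continuous_vel ⟨0, h0.le⟩
          ⟨t, not_lt.1 hcon⟩
        exact hv0 s hs
      rw [← habs, abs_of_neg this]; ring
    · refine ⟨1, Or.inl rfl, fun t => ?_⟩
      have : 0 < v t := by
        by_contra hcon
        obtain ⟨s, hs⟩ := mem_range_of_exists_le_of_exists_ge h.continuous_vel
          ⟨t, not_lt.1 hcon⟩ ⟨0, h0.le⟩
        exact hv0 s hs
      rw [← habs, abs_of_pos this]; ring
  have hσ2 : σ * σ = 1 := by rcases hσ with rfl | rfl <;> norm_num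
  have hxQ : x Q = x 0 + m := by simpa using hm 0
  have hsub : ∀ g : ℝ → ℝ, Continuous g → Function.Periodic g 1 →
      ∫ t in (0 : ℝ)..Q, g (x t) * v t = m * ∫ ξ in (0 : ℝ)..1, g ξ := fun g hg hgp => by
    have := intervalIntegral.integral_comp_mul_deriv (a := 0) (b := Q)
      (fun t _ => h.hasDerivAt_pos t) h.continuous_vel.continuousOn hg
    rw [← hgp.integral_drift hg (x 0) m, ← hxQ, ← this]
    rfl
  have hQe : σ * Q = m * invSqrtMean (fun ξ => u ξ - c) := by
    rw [invSqrtMean, ← hsub _ hci hpi]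
    have : ∀ t, (√(u (x t) - c))⁻¹ * v t = σ := fun t => by
      rw [hvσ, mul_comm σ, ← mul_assoc, inv_mul_cancel₀ (hpos _).ne', one_mul]
    simp [this, mul_comm]
  have hSe : σ * ∫ t in (0 : ℝ)..Q, v t ^ 2 = m * sqrtMean (fun ξ => u ξ - c) := by
    rw [sqrtMean, ← hsub _ hcs hps, ← intervalIntegral.integral_const_mul]
    congr 1
    funext t
    rw [hvσ t]
    linear_combination σ * √(u (x t) - c) ^ 2 * hσ2
  have hB : 0 < invSqrtMean (fun ξ => u ξ - c) :=
    intervalIntegral.intervalIntegral_pos_of_pos (hci.intervalIntegrable _ _)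
      (fun ξ => inv_pos.2 (hpos ξ)) one_pos
  have hσm : |(m : ℝ)| = σ * m := by
    have h1 : 0 < σ * m := by
      have h2 : 0 < (σ * m) * invSqrtMean (fun ξ => u ξ - c) := by
        have : (σ * m) * invSqrtMean (fun ξ => u ξ - c) = Q := by
          linear_combination Q * hσ2 - σ * hQe
        rwa [this]
      exact (pos_iff_pos_of_mul_pos h2).2 hB
    rw [← abs_of_pos h1, abs_mul]
    rcases hσ with rfl | rfl <;> simp
  refine ⟨fun h0 => ?_, ?_, ?_⟩
  · rw [h0] at hQe
    rcases hσ with rfl | rfl <;> simp at hQe <;> exact hQ.ne' hQe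
  · rw [hσm]; linear_combination σ * hQe - Q * hσ2
  · rw [hσm]; linear_combination σ * hSe - (∫ t in (0 : ℝ)..Q, v t ^ 2) * hσ2

/-! ### Separated closed orbits -/

/-- The actions `∫ (x'² + y'²)` of the closed orbits in the class `(m, n)` of the separated system
`x'' = u'(x) / 2`, `y'' = w'(y) / 2` on the energy level `x'² + y'² = u(x) + w(y)`. -/
def separatedSpectrum (u w : ℝ → ℝ) (m n : ℤ) : Set ℝ :=
  {ℓ | ∃ (x v y z : ℝ → ℝ) (Q : ℝ), 0 < Q ∧ NewtonSolution u x v ∧ NewtonSolution w y z ∧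
    (∀ t, v t ^ 2 + z t ^ 2 = u (x t) + w (y t)) ∧ (∀ t, x (t + Q) = x t + m) ∧
    (∀ t, y (t + Q) = y t + n) ∧ ℓ = ∫ t in (0 : ℝ)..Q, (v t ^ 2 + z t ^ 2)}

/-- Reduces the oscillatory classes `(m, 0)` to the classes `(0, n)`. -/
theorem separatedSpectrum_swap {u w : ℝ → ℝ} {m n : ℤ} {ℓ : ℝ} (h : ℓ ∈ separatedSpectrum u w m n) :
    ℓ ∈ separatedSpectrum w u n m := by
  obtain ⟨x, v, y, z, Q, hQ, hx, hy, hE, hm, hn, rfl⟩ := h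
  exact ⟨y, z, x, v, Q, hQ, hy, hx, fun t => by linarith [hE t], hn, hm, by simp only [add_comm]⟩

section

variable {u w : ℝ → ℝ}

/-- Both coordinates drift, hence both rotate, at the levels `c` and `-c`. The common period is the
critical point equation for the action as a function of `c`. -/
theorem exists_level_of_mem_separatedSpectrum (hu : ContDiff ℝ 2 u) (hw : ContDiff ℝ 2 w)
    (pu : Function.Periodic u 1) (pw : Function.Periodic w 1) {m n : ℤ} (hm : m ≠ 0) (hn : n ≠ 0)
    {ℓ : ℝ} (h : ℓ ∈ separatedSpectrum u w m n) :
    ∃ c, (∀ ξ, c < u ξ) ∧ (∀ ξ, 0 < w ξ + c) ∧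
      |(m : ℝ)| * invSqrtMean (fun ξ => u ξ - c) = |(n : ℝ)| * invSqrtMean (fun ξ => w ξ + c) ∧
      ℓ = |(m : ℝ)| * sqrtMean (fun ξ => u ξ - c) + |(n : ℝ)| * sqrtMean (fun ξ => w ξ + c) := by
  obtain ⟨x, v, y, z, Q, hQ, hx, hy, hE, hxQ, hyQ, rfl⟩ := h
  obtain ⟨K, -, bu⟩ := exists_c2Bound hu pu
  obtain ⟨K', -, bw⟩ := exists_c2Bound hw pw
  set c := u (x 0) - v 0 ^ 2 with hc
  have hv : ∀ t, v t ^ 2 = u (x t) - c := fun t => by linarith [hx.energy_eq bu t 0]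
  have hz : ∀ t, z t ^ 2 = w (y t) - (-c) := fun t => by linarith [hE t, hv t]
  have h1 := hx.level_lt_of_drift bu hxQ hm hv
  have h2 := hy.level_lt_of_drift bw hyQ hn hz
  obtain ⟨-, hB1, hA1⟩ := hx.rotation bu pu hQ hxQ hv h1
  obtain ⟨-, hB2, hA2⟩ := hy.rotation bw pw hQ hyQ hz h2
  simp only [sub_neg_eq_add] at hB2 hA2
  refine ⟨c, h1, fun ξ => by linarith [h2 ξ], by rw [← hB1, ← hB2], ?_⟩
  rw [← hA1, ← hA2]
  exact intervalIntegral.integral_add ((hx.continuous_vel.pow 2).intervalIntegrable _ _)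
    ((hy.continuous_vel.pow 2).intervalIntegrable _ _)

/-- Without drift `x` is periodic, so Rolle's theorem gives a time of rest, which fixes the level as
a value of `u`. Positivity of `u + w` then forces `y` to rotate; in particular there are no orbits
in the class `(0, 0)`. -/
theorem exists_turning_point_of_mem_separatedSpectrum (hu : ContDiff ℝ 2 u) (hw : ContDiff ℝ 2 w)
    (pu : Function.Periodic u 1) (pw : Function.Periodic w 1) (hpos : ∀ ξ η, 0 < u ξ + w η)
    {n : ℤ} {ℓ : ℝ} (h : ℓ ∈ separatedSpectrum u w 0 n) :
    n ≠ 0 ∧ ∃ (x v : ℝ → ℝ) (Q : ℝ), 0 < Q ∧ NewtonSolution u x v ∧ x 0 ∈ Icc (0 : ℝ) 1 ∧ v 0 = 0 ∧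
      x Q = x 0 ∧ v Q = 0 ∧ Q = |(n : ℝ)| * invSqrtMean (fun ξ => w ξ + u (x 0)) ∧
      ℓ = (∫ t in (0 : ℝ)..Q, v t ^ 2) + |(n : ℝ)| * sqrtMean (fun ξ => w ξ + u (x 0)) := by
  obtain ⟨x, v, y, z, Q, hQ, hx, hy, hE, hxQ, hyQ, rfl⟩ := h
  obtain ⟨K, -, bu⟩ := exists_c2Bound hu pu
  obtain ⟨K', -, bw⟩ := exists_c2Bound hw pw
  have hxp : Function.Periodic x Q := fun t => by simpa using hxQ t
  have hvp : Function.Periodic v Q := fun t => by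
    have h1 := (hx.hasDerivAt_pos (t + Q)).comp_add_const t Q
    have h2 := hx.hasDerivAt_pos t
    rw [show (fun t => x (t + Q)) = x from funext hxp] at h1
    exact h1.unique h2
  obtain ⟨t₀, -, ht₀⟩ := exists_hasDerivAt_eq_zero hQ hx.continuous_pos.continuousOn
    (by simpa using (hxp 0).symm) (fun t _ => hx.hasDerivAt_pos t)
  set c := u (x t₀) with hc
  have hv : ∀ t, v t ^ 2 = u (x t) - c := fun t => by
    have := hx.energy_eq bu t t₀
    rw [ht₀] at this
    linarith
  have hz : ∀ t, z t ^ 2 = w (y t) - (-c) := fun t => by linarith [hE t, hv t]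
  obtain ⟨hn, hB, hA⟩ := hy.rotation bw pw hQ hyQ hz (fun ξ => by linarith [hpos (x t₀) ξ])
  simp only [sub_neg_eq_add] at hB hA
  -- Time is shifted to start at the turning point, and an integer translation puts that point in
  -- `[0, 1]`, as the later pigeonhole argument requires.
  have hc' : u (x t₀ + (-⌊x t₀⌋ : ℤ)) = c := by simpa using pu.int_mul (-⌊x t₀⌋) (x t₀)
  have h0 : x (0 + t₀) + (-⌊x t₀⌋ : ℤ) = x t₀ + (-⌊x t₀⌋ : ℤ) := by simp
  refine ⟨hn, fun t => x (t + t₀) + (-⌊x t₀⌋ : ℤ), fun t => v (t + t₀), Q, hQ,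
    (hx.comp_add_const t₀).add_int pu _, ?_, ?_, ?_, ?_, ?_, ?_⟩
  · push_cast
    rw [zero_add, ← sub_eq_add_neg]
    exact ⟨Int.fract_nonneg _, (Int.fract_lt_one _).le⟩
  · simpa using ht₀
  · change x (Q + t₀) + _ = x (0 + t₀) + _
    rw [add_comm Q, hxp, zero_add]
  · change v (Q + t₀) = 0
    rw [add_comm Q, hvp, ht₀]
  · beta_reduce
    rw [h0, hc', ← hB]
  · beta_reduce
    rw [h0, hc', ← hA]
    have e : ∫ t in (0 : ℝ)..Q, v (t + t₀) ^ 2 = ∫ t in (0 : ℝ)..Q, v t ^ 2 := by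
      rw [intervalIntegral.integral_comp_add_right (fun t => v t ^ 2), zero_add]
      have hp2 : Function.Periodic (fun t => v t ^ 2) Q := fun t => by
        change v (t + Q) ^ 2 = v t ^ 2
        rw [hvp]
      have := hp2.intervalIntegral_add_eq t₀ 0
      rwa [zero_add, add_comm t₀ Q] at this
    simp only [e]
    exact intervalIntegral.integral_add ((hx.continuous_vel.pow 2).intervalIntegrable _ _)
      ((hy.continuous_vel.pow 2).intervalIntegrable _ _)

end

/-! ### Concavity -/

theorem Real.sqrt_sub_sqrt_le {a b : ℝ} (ha : 0 < a) (hb : 0 ≤ b) :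
    √b - √a ≤ (b - a) * (√a)⁻¹ / 2 := by
  have h1 : 0 < √a := Real.sqrt_pos.2 ha
  have h2 := Real.sq_sqrt ha.le
  have h3 := Real.sq_sqrt hb
  rw [← div_eq_mul_inv, div_div, le_div_iff₀ (by positivity)]
  nlinarith [sq_nonneg (√b - √a)]

section

variable {h h₀ h₁ : ℝ → ℝ}

theorem Continuous.inv_sqrt (hc : Continuous h) (hpos : ∀ x, 0 < h x) :
    Continuous fun x => (√(h x))⁻¹ :=
  hc.sqrt.inv₀ fun x => (Real.sqrt_pos.2 (hpos x)).ne'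

/-- The tangent line inequality for the concave square root, integrated. It serves both for
variations of the level and for variations of the potential. -/
theorem sqrtMean_sub_le (c₀ : Continuous h₀) (c₁ : Continuous h₁) (p₀ : ∀ x, 0 < h₀ x)
    (p₁ : ∀ x, 0 ≤ h₁ x) :
    sqrtMean h₁ - sqrtMean h₀ ≤ (∫ x in (0 : ℝ)..1, (h₁ x - h₀ x) * (√(h₀ x))⁻¹) / 2 := by
  rw [sqrtMean, sqrtMean, ← intervalIntegral.integral_sub (c₁.sqrt.intervalIntegrable _ _)
    (c₀.sqrt.intervalIntegrable _ _), ← intervalIntegral.integral_div]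
  refine intervalIntegral.integral_mono zero_le_one
    ((c₁.sqrt.sub c₀.sqrt).intervalIntegrable _ _)
    ((((c₁.sub c₀).mul (c₀.inv_sqrt p₀)).div_const 2).intervalIntegrable _ _) fun x => ?_
  exact Real.sqrt_sub_sqrt_le (p₀ x) (p₁ x)

theorem sqrtMean_add_sub_le (hc : Continuous h) {c c' : ℝ} (p₀ : ∀ x, 0 < h x + c)
    (p₁ : ∀ x, 0 ≤ h x + c') :
    sqrtMean (fun x => h x + c') - sqrtMean (fun x => h x + c) ≤
      (c' - c) * invSqrtMean (fun x => h x + c) / 2 := by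
  have := sqrtMean_sub_le (h₀ := fun x => h x + c) (h₁ := fun x => h x + c')
    (hc.add continuous_const) (hc.add continuous_const) p₀ p₁
  refine this.trans (le_of_eq ?_)
  rw [invSqrtMean, ← intervalIntegral.integral_const_mul]
  congr 2
  funext x
  ring

theorem invSqrtMean_pos (hc : Continuous h) (p : ∀ x, 0 < h x) : 0 < invSqrtMean h :=
  intervalIntegral.intervalIntegral_pos_of_pos ((hc.inv_sqrt p).intervalIntegrable _ _)
    (fun ξ => inv_pos.2 (Real.sqrt_pos.2 (p ξ))) one_pos

theorem invSqrtMean_le (c₀ : Continuous h₀) (c₁ : Continuous h₁) (p₀ : ∀ x, 0 < h₀ x)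
    (hle : ∀ x, h₀ x ≤ h₁ x) : invSqrtMean h₁ ≤ invSqrtMean h₀ := by
  refine intervalIntegral.integral_mono zero_le_one
    ((c₁.inv_sqrt fun x => (p₀ x).trans_le (hle x)).intervalIntegrable _ _)
    ((c₀.inv_sqrt p₀).intervalIntegrable _ _) fun x => ?_
  exact inv_anti₀ (Real.sqrt_pos.2 (p₀ x)) (Real.sqrt_le_sqrt (hle x))

theorem invSqrtMean_lt (c₀ : Continuous h₀) (c₁ : Continuous h₁) (p₀ : ∀ x, 0 < h₀ x)
    (hlt : ∀ x, h₀ x < h₁ x) : invSqrtMean h₁ < invSqrtMean h₀ := by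
  have hi1 := ((c₁.inv_sqrt fun x => (p₀ x).trans (hlt x)).intervalIntegrable
    (μ := MeasureTheory.volume) 0 1)
  have hi0 := (c₀.inv_sqrt p₀).intervalIntegrable (μ := MeasureTheory.volume) 0 1
  have := intervalIntegral.intervalIntegral_pos_of_pos (hi0.sub hi1)
    (fun x => sub_pos.2 (inv_strictAnti₀ (Real.sqrt_pos.2 (p₀ x))
      (Real.sqrt_lt_sqrt (p₀ x).le (hlt x)))) one_pos
  rw [intervalIntegral.integral_sub hi0 hi1] at this
  exact sub_pos.1 this

end

section

variable {u w : ℝ → ℝ}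

/-- The action in a class `(m, n)` with `mn ≠ 0` is the maximum of a concave function. -/
theorem le_of_critical_level (hu : Continuous u) (hw : Continuous w) {M N c c' : ℝ} (hM : 0 ≤ M)
    (hN : 0 ≤ N) (hcu : ∀ ξ, c < u ξ) (hcw : ∀ ξ, 0 < w ξ + c)
    (hcrit : M * invSqrtMean (fun ξ => u ξ - c) = N * invSqrtMean (fun ξ => w ξ + c))
    (hcu' : ∀ ξ, c' ≤ u ξ) (hcw' : ∀ ξ, 0 ≤ w ξ + c') :
    M * sqrtMean (fun ξ => u ξ - c') + N * sqrtMean (fun ξ => w ξ + c') ≤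
      M * sqrtMean (fun ξ => u ξ - c) + N * sqrtMean (fun ξ => w ξ + c) := by
  have h1 := sqrtMean_add_sub_le (h := u) hu (c := -c) (c' := -c') (fun x => by linarith [hcu x])
    (fun x => by linarith [hcu' x])
  have h2 := sqrtMean_add_sub_le (h := w) hw (c := c) (c' := c') hcw hcw'
  simp only [← sub_eq_add_neg] at h1
  have h3 := mul_le_mul_of_nonneg_left h1 hM
  have h4 := mul_le_mul_of_nonneg_left h2 hN
  -- The linear terms of the two tangent lines cancel by criticality.
  linear_combination h3 + h4 + (c - c') / 2 * hcrit

/-- Any two critical levels both maximize the same concave function, hence give the same action. -/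
theorem separatedSpectrum_subsingleton (hu : ContDiff ℝ 2 u) (hw : ContDiff ℝ 2 w)
    (pu : Function.Periodic u 1) (pw : Function.Periodic w 1) {m n : ℤ} (hm : m ≠ 0) (hn : n ≠ 0) :
    (separatedSpectrum u w m n).Subsingleton := by
  have key : ∀ ℓ ∈ separatedSpectrum u w m n, ∀ ℓ' ∈ separatedSpectrum u w m n, ℓ ≤ ℓ' := by
    intro ℓ hℓ ℓ' hℓ'
    obtain ⟨c, h1, h2, -, rfl⟩ := exists_level_of_mem_separatedSpectrum hu hw pu pw hm hn hℓ
    obtain ⟨c', h1', h2', h3', rfl⟩ := exists_level_of_mem_separatedSpectrum hu hw pu pw hm hn hℓ'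
    exact le_of_critical_level hu.continuous hw.continuous (abs_nonneg _) (abs_nonneg _) h1' h2' h3'
      (fun ξ => (h1 ξ).le) fun ξ => (h2 ξ).le
  exact fun ℓ hℓ ℓ' hℓ' => le_antisymm (key _ hℓ _ hℓ') (key _ hℓ' _ hℓ)

end

/-! ### Weighted means -/

/-- As `e` grows the ratio `(b + e) / (a + e)` moves towards 1: upwards if `a > b`, downwards if `a
< b`. The factor `a - b` makes both cases increasing. -/
theorem sub_mul_sqrt_div_mono {a b e e' : ℝ} (hee : e < e') (ha : 0 < a + e) (hb : 0 < b + e) :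
    (a - b) * (√(b + e) * (√(a + e))⁻¹) ≤ (a - b) * (√(b + e') * (√(a + e'))⁻¹) ∧
      (a ≠ b → (a - b) * (√(b + e) * (√(a + e))⁻¹) < (a - b) * (√(b + e') * (√(a + e'))⁻¹)) := by
  have ha' : 0 < a + e' := by linarith
  have hb' : 0 < b + e' := by linarith
  have hq : ∀ f, √(b + f) * (√(a + f))⁻¹ = √((b + f) / (a + f)) ∨ b + f < 0 := fun f => by
    by_cases h : 0 ≤ b + f
    · left; rw [Real.sqrt_div h, div_eq_mul_inv]
    · right; linarith
  have h1 := (hq e).resolve_right (by linarith)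
  have h2 := (hq e').resolve_right (by linarith)
  rw [h1, h2]
  have hlt : a ≠ b → (a - b) * √((b + e) / (a + e)) < (a - b) * √((b + e') / (a + e')) := by
    intro hab
    rcases lt_or_gt_of_ne hab with h | h
    · refine mul_lt_mul_of_neg_left (Real.sqrt_lt_sqrt (by positivity) ?_) (by linarith)
      rw [div_lt_div_iff₀ ha' ha]
      nlinarith
    · refine mul_lt_mul_of_pos_left (Real.sqrt_lt_sqrt (by positivity) ?_) (by linarith)
      rw [div_lt_div_iff₀ ha ha']
      nlinarith
  refine ⟨?_, hlt⟩
  by_cases hab : a = b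
  · simp [hab]
  · exact (hlt hab).le

/-- The perturbation `w - μ` with `μ` the mean of `w` for the weight `1/√(w + e₀)` decreases the
action of the levels below `e₀` and increases the action of the levels above. -/
theorem exists_weighted_mean {w : ℝ → ℝ} (hw : Continuous w) (pw : Function.Periodic w 1)
    (hnc : ∃ ξ η, w ξ ≠ w η) {e₀ : ℝ} (he₀ : ∀ ξ, 0 < w ξ + e₀) :
    ∃ μ, (∀ e, (∀ ξ, 0 < w ξ + e) → 0 < μ + e) ∧
      (∀ e ≤ e₀, (∀ ξ, 0 < w ξ + e) → ∫ ξ in (0 : ℝ)..1, (w ξ - μ) * (√(w ξ + e))⁻¹ ≤ 0) ∧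
      (∀ e₁ > e₀, ∀ M, ∃ κ > 0, ∀ e, e₁ ≤ e → e ≤ M →
        κ ≤ ∫ ξ in (0 : ℝ)..1, (w ξ - μ) * (√(w ξ + e))⁻¹) := by
  have hci : ∀ {e}, (∀ ξ, 0 < w ξ + e) → Continuous fun ξ => (√(w ξ + e))⁻¹ := fun he =>
    (hw.add continuous_const).inv_sqrt he
  have hB : 0 < invSqrtMean fun ξ => w ξ + e₀ := invSqrtMean_pos (hw.add continuous_const) he₀
  set B := invSqrtMean fun ξ => w ξ + e₀ with hBdef
  set μ := (∫ ξ in (0 : ℝ)..1, w ξ * (√(w ξ + e₀))⁻¹) / B with hμ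
  have hlin : ∀ e, ∫ ξ in (0 : ℝ)..1, (w ξ + e) * (√(w ξ + e₀))⁻¹ = (μ + e) * B := fun e => by
    simp only [add_mul]
    rw [intervalIntegral.integral_add (f := fun ξ => w ξ * (√(w ξ + e₀))⁻¹)
      (g := fun ξ => e * (√(w ξ + e₀))⁻¹) ((hw.mul (hci he₀)).intervalIntegrable _ _)
      ((continuous_const.mul (hci he₀)).intervalIntegrable _ _),
      intervalIntegral.integral_const_mul, hμ, div_mul_cancel₀ _ hB.ne', hBdef, invSqrtMean]
  have hμpos : ∀ e, (∀ ξ, 0 < w ξ + e) → 0 < μ + e := fun e he => by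
    have : 0 < (μ + e) * B := by
      rw [← hlin e]
      exact intervalIntegral.intervalIntegral_pos_of_pos
        (((hw.add continuous_const).mul (hci he₀)).intervalIntegrable _ _)
        (fun ξ => mul_pos (he ξ) (inv_pos.2 (Real.sqrt_pos.2 (he₀ ξ)))) one_pos
    exact (pos_iff_pos_of_mul_pos this).2 hB
  have hzero : ∫ ξ in (0 : ℝ)..1, (w ξ - μ) * (√(w ξ + e₀))⁻¹ = 0 := by
    have := hlin (-μ)
    simpa [← sub_eq_add_neg] using this
  obtain ⟨ξ₀, hξ₀, hne⟩ : ∃ ξ ∈ Icc (0 : ℝ) 1, w ξ ≠ μ := by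
    by_contra! hcon
    have hall : ∀ ξ, w ξ = μ := fun ξ => by
      have h1 := hcon (Int.fract ξ) ⟨Int.fract_nonneg _, (Int.fract_lt_one _).le⟩
      have h2 : w (ξ - ⌊ξ⌋) = w ξ := by simpa using pw.sub_int_mul_eq (x := ξ) ⌊ξ⌋
      rw [← h1, ← h2, Int.self_sub_floor]
    obtain ⟨ξ, η, h⟩ := hnc
    exact h ((hall ξ).trans (hall η).symm)
  -- The positive factor `√(μ + e)` does not change the sign of the integral but makes the integrand
  -- monotone in `e` at every `ξ`. Thus `H` increases strictly through its zero `e₀`.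
  let H : ℝ → ℝ := fun e => ∫ ξ in (0 : ℝ)..1, (w ξ - μ) * (√(μ + e) * (√(w ξ + e))⁻¹)
  have hH : ∀ e, H e = √(μ + e) * ∫ ξ in (0 : ℝ)..1, (w ξ - μ) * (√(w ξ + e))⁻¹ := fun e => by
    rw [← intervalIntegral.integral_const_mul]
    refine intervalIntegral.integral_congr fun ξ _ => ?_
    ring
  have hHc : ∀ {e}, (∀ ξ, 0 < w ξ + e) →
      Continuous fun ξ => (w ξ - μ) * (√(μ + e) * (√(w ξ + e))⁻¹) := fun he =>
    (hw.sub continuous_const).mul (continuous_const.mul (hci he))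
  have hmono : ∀ {e e'}, (∀ ξ, 0 < w ξ + e) → e < e' → H e < H e' := fun {e e'} he hee => by
    refine intervalIntegral.integral_lt_integral_of_continuousOn_of_le_of_exists_lt one_pos
      (hHc he).continuousOn (hHc fun ξ => by linarith [he ξ]).continuousOn
      (fun ξ _ => (sub_mul_sqrt_div_mono hee (he ξ) (hμpos e he)).1)
      ⟨ξ₀, hξ₀, (sub_mul_sqrt_div_mono hee (he ξ₀) (hμpos e he)).2 hne⟩
  have hH0 : H e₀ = 0 := by rw [hH, hzero, mul_zero]
  refine ⟨μ, hμpos, fun e hee he => ?_, fun e₁ he₁ M => ?_⟩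
  · have h1 : H e ≤ 0 := by
      rcases hee.eq_or_lt with rfl | hlt
      · exact hH0.le
      · exact ((hmono he hlt).trans_eq hH0).le
    rw [hH] at h1
    exact nonpos_of_mul_nonpos_right h1 (Real.sqrt_pos.2 (hμpos e he))
  · have hp1 : ∀ ξ, 0 < w ξ + e₁ := fun ξ => by linarith [he₀ ξ]
    have h1 : 0 < H e₁ := hH0.symm.trans_lt (hmono he₀ he₁)
    -- Taking `max e₁ M` keeps the denominator positive even when `M < e₁`.
    have hM : 0 < √(μ + max e₁ M) :=
      Real.sqrt_pos.2 ((hμpos _ hp1).trans_le (by gcongr; exact le_max_left _ _))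
    refine ⟨H e₁ / √(μ + max e₁ M), by positivity, fun e hle heM => ?_⟩
    have hpe : ∀ ξ, 0 < w ξ + e := fun ξ => by linarith [hp1 ξ]
    have h2 : H e₁ ≤ H e := by
      rcases hle.eq_or_lt with rfl | hlt
      · exact le_rfl
      · exact (hmono hp1 hlt).le
    have h3 : √(μ + e) ≤ √(μ + max e₁ M) :=
      Real.sqrt_le_sqrt (by gcongr; exact heM.trans (le_max_right _ _))
    rw [div_le_iff₀ hM]
    refine h2.trans ?_
    rw [hH, mul_comm]
    refine mul_le_mul_of_nonneg_left h3 ?_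
    have h4 : 0 < H e := h1.trans_le h2
    rw [hH] at h4
    exact ((pos_iff_pos_of_mul_pos h4).1 (Real.sqrt_pos.2 (hμpos e hpe))).le

/-! ### First variation of the action of librations -/

theorem NewtonSolution.abs_vel_le {u x v : ℝ → ℝ} {K : ℝ} (h : NewtonSolution u x v)
    (hu : C2Bound u K) {s : ℝ} (hs : v s = 0) (t : ℝ) : |v t| ≤ K * |t - s| := by
  have := Convex.norm_image_sub_le_of_norm_hasDerivWithin_le (𝕜 := ℝ) (f := v) (C := K) (s := univ)
    (x := s) (y := t) (fun z _ => (h.hasDerivAt_vel z).hasDerivWithinAt)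
    (fun z _ => by
      rw [Real.norm_eq_abs, abs_div, abs_two]
      linarith [hu.abs_deriv_le (x z), abs_nonneg (deriv u (x z))])
    convex_univ (mem_univ _) (mem_univ _)
  simpa [hs] using this

/-- By conservation of energy, `∫ v² + u (x 0) * Q / 2` is the Lagrangian action `∫ (v² + u(x)) /
2`. Along a solution its first variation consists of boundary terms: those in the position vanish
because the orbit is at rest at both ends, and moving the final time contributes the Lagrangian `u
(x₀ 0) / 2` there. Only a quadratic remainder is left, even though neighbouring librations need not
close up at the same time. -/
theorem exists_action_variation {u : ℝ → ℝ} {K : ℝ} (hu : C2Bound u K) {R : ℝ} (hR : 0 ≤ R) :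
    ∃ C, 0 ≤ C ∧ ∀ x₀ v₀ x₁ v₁ : ℝ → ℝ, ∀ Q₀ Q₁ : ℝ, NewtonSolution u x₀ v₀ → NewtonSolution u x₁ v₁ →
      0 ≤ Q₀ → Q₀ ≤ R → 0 ≤ Q₁ → Q₁ ≤ R → v₀ 0 = 0 → v₁ 0 = 0 → v₀ Q₀ = 0 → v₁ Q₁ = 0 →
      |(∫ t in (0 : ℝ)..Q₁, v₁ t ^ 2) + u (x₁ 0) * Q₁ / 2 -
          ((∫ t in (0 : ℝ)..Q₀, v₀ t ^ 2) + u (x₀ 0) * Q₀ / 2) - u (x₀ 0) / 2 * (Q₁ - Q₀)| ≤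
        C * ((x₁ 0 - x₀ 0) ^ 2 + (Q₁ - Q₀) ^ 2) := by
  have hK := hu.nonneg
  set E := Real.exp (max 1 K * R)
  have hE : 0 ≤ E := (Real.exp_pos _).le
  refine ⟨R * (1 + K) * E ^ 2 + K ^ 2 * R + K, by positivity, ?_⟩
  intro x₀ v₀ x₁ v₁ Q₀ Q₁ h₀ h₁ hQ₀ hQ₀R hQ₁ hQ₁R i₀ i₁ f₀ f₁
  set a := x₁ 0 - x₀ 0 with ha
  set q := Q₁ - Q₀ with hq
  have e₀ : ∀ t, v₀ t ^ 2 = u (x₀ t) - u (x₀ 0) := fun t => by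
    have := h₀.energy_eq hu t 0
    rw [i₀] at this
    linarith
  have e₁ : ∀ t, v₁ t ^ 2 = u (x₁ t) - u (x₁ 0) := fun t => by
    have := h₁.energy_eq hu t 0
    rw [i₁] at this
    linarith
  have cu := hu.contDiff.continuous
  have cu' := hu.contDiff_deriv.continuous
  have cv₀ := h₀.continuous_vel
  have cv₁ := h₁.continuous_vel
  have cx₀ := h₀.continuous_pos
  have cx₁ := h₁.continuous_pos
  have ii : ∀ {f : ℝ → ℝ}, Continuous f → ∀ a b,
    IntervalIntegrable f MeasureTheory.volume a b := fun hf a b => hf.intervalIntegrable a b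
  -- The first variation is the derivative of `v₀ * (x₁ - x₀)`, which vanishes at both ends.
  have hP : ∫ t in (0 : ℝ)..Q₀, (deriv u (x₀ t) / 2 * (x₁ t - x₀ t) + v₀ t * (v₁ t - v₀ t)) = 0 := by
    rw [intervalIntegral.integral_eq_sub_of_hasDerivAt (f := fun t => v₀ t * (x₁ t - x₀ t))
      (fun t _ => (h₀.hasDerivAt_vel t).mul ((h₁.hasDerivAt_pos t).sub (h₀.hasDerivAt_pos t)))
      (ii (by fun_prop) _ _), f₀, i₀]
    simp
  have hA : |∫ t in (0 : ℝ)..Q₀, ((v₁ t ^ 2 + u (x₁ t)) / 2 - (v₀ t ^ 2 + u (x₀ t)) / 2 -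
      (deriv u (x₀ t) / 2 * (x₁ t - x₀ t) + v₀ t * (v₁ t - v₀ t)))| ≤
      ((1 + K) * (|a| * E) ^ 2) * |Q₀ - 0| := by
    rw [← Real.norm_eq_abs]
    refine intervalIntegral.norm_integral_le_of_norm_le_const fun t ht => ?_
    rw [uIoc_of_le hQ₀] at ht
    obtain ⟨b1, b2⟩ := h₀.abs_sub_le hu h₁ i₀ i₁ ht.1.le (ht.2.trans hQ₀R)
    have b3 := hu.abs_taylor_le (x₀ t) (x₁ t)
    have b4 : (x₁ t - x₀ t) ^ 2 ≤ (|a| * E) ^ 2 := by rw [← sq_abs]; gcongr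
    have b5 : (v₁ t - v₀ t) ^ 2 ≤ (|a| * E) ^ 2 := by rw [← sq_abs (_ - _)]; gcongr
    have b6 := mul_le_mul_of_nonneg_left b4 hK
    rw [Real.norm_eq_abs]
    have : (v₁ t ^ 2 + u (x₁ t)) / 2 - (v₀ t ^ 2 + u (x₀ t)) / 2 -
        (deriv u (x₀ t) / 2 * (x₁ t - x₀ t) + v₀ t * (v₁ t - v₀ t)) =
        (v₁ t - v₀ t) ^ 2 / 2 + (u (x₁ t) - u (x₀ t) - deriv u (x₀ t) * (x₁ t - x₀ t)) / 2 := by ring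
    rw [this, abs_le]
    rw [abs_le] at b3
    have := sq_nonneg (v₁ t - v₀ t)
    have := sq_nonneg (|a| * E)
    constructor <;> linarith
  rw [intervalIntegral.integral_sub (ii (by fun_prop) _ _) (ii (by fun_prop) _ _), hP, sub_zero,
    intervalIntegral.integral_sub (ii (by fun_prop) _ _) (ii (by fun_prop) _ _)] at hA
  -- On the short interval between `Q₀` and `Q₁` the orbit `x₁` is nearly at rest, so its Lagrangian
  -- is close to the constant `u (x₀ 0) / 2`.
  have hB : |∫ t in Q₀..Q₁, ((v₁ t ^ 2 + u (x₁ t)) / 2 - u (x₀ 0) / 2)| ≤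
      ((K * |q|) ^ 2 + K * |a| / 2) * |Q₁ - Q₀| := by
    rw [← Real.norm_eq_abs]
    refine intervalIntegral.norm_integral_le_of_norm_le_const fun t ht => ?_
    have ht' : |t - Q₁| ≤ |q| := by
      rw [hq, abs_sub_comm t]
      exact abs_sub_right_of_mem_uIcc (uIoc_subset_uIcc ht)
    have b1 : |v₁ t| ≤ K * |q| :=
      (h₁.abs_vel_le hu f₁ t).trans (mul_le_mul_of_nonneg_left ht' hK)
    have b2 : v₁ t ^ 2 ≤ (K * |q|) ^ 2 := by rw [← sq_abs]; gcongr
    have b3 := hu.abs_sub_le (x₁ 0) (x₀ 0)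
    rw [← ha, abs_le] at b3
    rw [Real.norm_eq_abs, abs_le]
    have := e₁ t
    have := sq_nonneg (v₁ t)
    constructor <;> linarith
  rw [intervalIntegral.integral_sub (ii (by fun_prop) _ _) (ii (by fun_prop) _ _),
    intervalIntegral.integral_const, ← hq, smul_eq_mul] at hB
  have w₁ : ∫ t in (0 : ℝ)..Q₁, (v₁ t ^ 2 + u (x₁ t)) / 2 =
      (∫ t in (0 : ℝ)..Q₁, v₁ t ^ 2) + u (x₁ 0) * Q₁ / 2 := by
    have : ∀ t, (v₁ t ^ 2 + u (x₁ t)) / 2 = v₁ t ^ 2 + u (x₁ 0) / 2 := fun t => by linarith [e₁ t]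
    simp only [this]
    rw [intervalIntegral.integral_add (ii (by fun_prop) _ _) (ii (by fun_prop) _ _)]
    simp
    ring
  have w₀ : ∫ t in (0 : ℝ)..Q₀, (v₀ t ^ 2 + u (x₀ t)) / 2 =
      (∫ t in (0 : ℝ)..Q₀, v₀ t ^ 2) + u (x₀ 0) * Q₀ / 2 := by
    have : ∀ t, (v₀ t ^ 2 + u (x₀ t)) / 2 = v₀ t ^ 2 + u (x₀ 0) / 2 := fun t => by linarith [e₀ t]
    simp only [this]
    rw [intervalIntegral.integral_add (ii (by fun_prop) _ _) (ii (by fun_prop) _ _)]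
    simp
    ring
  have hadd := intervalIntegral.integral_add_adjacent_intervals
    (ii (f := fun t => (v₁ t ^ 2 + u (x₁ t)) / 2) (by fun_prop) 0 Q₀)
    (ii (f := fun t => (v₁ t ^ 2 + u (x₁ t)) / 2) (by fun_prop) Q₀ Q₁)
  rw [← w₁, ← w₀, ← hadd]
  have hq' : |q| ≤ R := abs_le.2 ⟨by linarith, by linarith⟩
  have hA' : (1 + K) * (|a| * E) ^ 2 * |Q₀ - 0| ≤ R * (1 + K) * E ^ 2 * a ^ 2 := by
    rw [sub_zero, abs_of_nonneg hQ₀, mul_pow, sq_abs]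
    calc (1 + K) * (a ^ 2 * E ^ 2) * Q₀ ≤ (1 + K) * (a ^ 2 * E ^ 2) * R := by gcongr
      _ = _ := by ring
  have hB' : ((K * |q|) ^ 2 + K * |a| / 2) * |q| ≤ K ^ 2 * R * q ^ 2 + K * (a ^ 2 + q ^ 2) := by
    have b1 : (K * |q|) ^ 2 * |q| ≤ K ^ 2 * R * q ^ 2 := by
      calc (K * |q|) ^ 2 * |q| ≤ (K * |q|) ^ 2 * R := by gcongr
        _ = K ^ 2 * R * q ^ 2 := by rw [mul_pow, sq_abs]; ring
    have b2 : |a| * |q| ≤ a ^ 2 + q ^ 2 := by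
      rw [← sq_abs a, ← sq_abs q]
      nlinarith [sq_nonneg (|a| - |q|), sq_nonneg (|a| + |q|)]
    have b3 := mul_le_mul_of_nonneg_left b2 hK
    have b4 : 0 ≤ K * (|a| * |q|) := by positivity
    calc ((K * |q|) ^ 2 + K * |a| / 2) * |q| = (K * |q|) ^ 2 * |q| + K * (|a| * |q|) / 2 := by ring
      _ ≤ _ := by linarith
  have hsum := (abs_add_le _ _).trans (add_le_add (hA.trans hA') (hB.trans hB'))
  have : R * (1 + K) * E ^ 2 * a ^ 2 + (K ^ 2 * R * q ^ 2 + K * (a ^ 2 + q ^ 2)) ≤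
      (R * (1 + K) * E ^ 2 + K ^ 2 * R + K) * (a ^ 2 + q ^ 2) := by
    have h1 : 0 ≤ R * (1 + K) * E ^ 2 * q ^ 2 := by positivity
    have h2 : 0 ≤ K ^ 2 * R * a ^ 2 := by positivity
    linarith
  refine le_trans (le_of_eq ?_) (hsum.trans this)
  congr 1
  ring

/-! ### A pigeonhole argument -/

/-- Among about `N` equally spaced parameters two have values within `1/N`. Their squared difference
is at most `1/N²`, while the parameters are about `ε/N` apart, which wins for large `N`. The
function `a` may be arbitrarily wild. -/
theorem exists_lt_of_sq_control {ε C : ℝ} (hε : 0 < ε) (a : ℝ → ℝ)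
    (ha : ∀ s ∈ Icc 0 ε, a s ∈ Icc (0 : ℝ) 1) :
    ∃ s ∈ Icc 0 ε, ∃ s' ∈ Icc 0 ε, s < s' ∧ C * (a s' - a s) ^ 2 < s' - s := by
  obtain ⟨N, hN⟩ := exists_nat_gt (max 1 (2 * |C| / ε))
  have hN1 : (1 : ℝ) < N := (le_max_left _ _).trans_lt hN
  have hNC : 2 * |C| < N * ε := by
    rw [← div_lt_iff₀ hε]
    exact (le_max_right _ _).trans_lt hN
  let p : ℕ → ℝ := fun j => j * (ε / (N + 1))
  have hp : ∀ j ∈ Finset.range (N + 2), p j ∈ Icc 0 ε := fun j hj => by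
    have hj' : (j : ℝ) ≤ N + 1 := by exact_mod_cast Nat.lt_succ_iff.1 (Finset.mem_range.1 hj)
    refine ⟨by positivity, ?_⟩
    calc (j : ℝ) * (ε / (N + 1)) ≤ (N + 1) * (ε / (N + 1)) := by gcongr
      _ = ε := by field_simp
  -- There are `N + 1` boxes rather than `N`, because the value 1 has floor `N`; hence `N + 2`
  -- sample points.
  obtain ⟨i, hi, j, hj, hij, hfl⟩ := Finset.exists_ne_map_eq_of_card_lt_of_maps_to
    (s := Finset.range (N + 2)) (t := Finset.range (N + 1)) (by simp)
    (f := fun j => ⌊N * a (p j)⌋₊) (fun j hj => by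
      have h1 := ha _ (hp j hj)
      rw [Finset.coe_range, mem_Iio, Nat.lt_succ_iff]
      exact Nat.floor_le_of_le (by nlinarith [h1.2]))
  wlog hlt : i < j generalizing i j
  · exact this j hj i hi hij.symm hfl.symm (lt_of_le_of_ne (not_lt.1 hlt) hij.symm)
  refine ⟨p i, hp i hi, p j, hp j hj, ?_, ?_⟩
  · simp only [p]; gcongr
  have hd : ε / (N + 1) ≤ p j - p i := by
    have : (i : ℝ) + 1 ≤ j := by exact_mod_cast hlt
    simp only [p]
    rw [← sub_mul]
    exact le_mul_of_one_le_left (by positivity) (by linarith)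
  have hclose : (a (p j) - a (p i)) ^ 2 ≤ 1 / (N : ℝ) ^ 2 := by
    have i1 := Nat.floor_le (mul_nonneg (by positivity : (0 : ℝ) ≤ N) (ha _ (hp i hi)).1)
    have i2 := Nat.lt_floor_add_one ((N : ℝ) * a (p i))
    have j1 := Nat.floor_le (mul_nonneg (by positivity : (0 : ℝ) ≤ N) (ha _ (hp j hj)).1)
    have j2 := Nat.lt_floor_add_one ((N : ℝ) * a (p j))
    rw [← hfl] at j1 j2
    rw [le_div_iff₀ (by positivity), ← mul_pow, sq_le_one_iff_abs_le_one, abs_le]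
    constructor <;> linarith
  refine lt_of_lt_of_le ?_ hd
  calc C * (a (p j) - a (p i)) ^ 2 ≤ |C| * (1 / (N : ℝ) ^ 2) := by
        gcongr; exact le_abs_self C
    _ < ε / (N + 1) := by
        rw [mul_one_div, div_lt_div_iff₀ (by positivity) (by positivity)]
        nlinarith [abs_nonneg C]

/-! ### Breaking coincidences in the family `w + s (w - μ)` -/

theorem Real.abs_inv_sqrt_sub_le {a b δ : ℝ} (hδ : 0 < δ) (ha : δ ≤ a) (hb : δ ≤ b) :
    |(√a)⁻¹ - (√b)⁻¹| ≤ (√δ)⁻¹ ^ 3 * |a - b| := by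
  have hd : 0 < √δ := Real.sqrt_pos.2 hδ
  have hsa : √δ ≤ √a := Real.sqrt_le_sqrt ha
  have hsb : √δ ≤ √b := Real.sqrt_le_sqrt hb
  have pa : 0 < √a := hd.trans_le hsa
  have pb : 0 < √b := hd.trans_le hsb
  have e1 : (√a)⁻¹ - (√b)⁻¹ = -((a - b) * ((√a)⁻¹ * (√b)⁻¹ * (√a + √b)⁻¹)) := by
    have h1 := Real.sq_sqrt (hδ.le.trans ha)
    have h2 := Real.sq_sqrt (hδ.le.trans hb)
    nth_rewrite 2 [← h1]
    nth_rewrite 2 [← h2]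
    field_simp
    ring
  rw [e1, abs_neg, abs_mul, mul_comm]
  refine mul_le_mul_of_nonneg_right ?_ (abs_nonneg _)
  rw [abs_of_pos (by positivity), pow_three', mul_assoc, mul_assoc]
  have h3 : (√a + √b)⁻¹ ≤ (√δ)⁻¹ := inv_anti₀ hd (by linarith)
  gcongr

theorem abs_invSqrtMean_sub_le {h₀ h₁ : ℝ → ℝ} {δ d : ℝ} (c₀ : Continuous h₀) (c₁ : Continuous h₁)
    (hδ : 0 < δ) (p₀ : ∀ x, δ ≤ h₀ x) (p₁ : ∀ x, δ ≤ h₁ x) (hd : ∀ x, |h₁ x - h₀ x| ≤ d) :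
    |invSqrtMean h₁ - invSqrtMean h₀| ≤ (√δ)⁻¹ ^ 3 * d := by
  have i₀ := c₀.inv_sqrt fun x => hδ.trans_le (p₀ x)
  have i₁ := c₁.inv_sqrt fun x => hδ.trans_le (p₁ x)
  rw [invSqrtMean, invSqrtMean, ← intervalIntegral.integral_sub (i₁.intervalIntegrable _ _)
    (i₀.intervalIntegrable _ _), ← Real.norm_eq_abs]
  refine (intervalIntegral.norm_integral_le_of_norm_le_const (C := (√δ)⁻¹ ^ 3 * d)
    fun x _ => ?_).trans (by simp)
  exact (Real.abs_inv_sqrt_sub_le hδ (p₁ x) (p₀ x)).trans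
    (mul_le_mul_of_nonneg_left (hd x) (by positivity))

theorem invSqrtMean_le_inv_sqrt {h : ℝ → ℝ} {δ : ℝ} (hc : Continuous h) (hδ : 0 < δ)
    (p : ∀ x, δ ≤ h x) : invSqrtMean h ≤ (√δ)⁻¹ := by
  have := intervalIntegral.integral_mono (g := fun _ => (√δ)⁻¹) zero_le_one
    ((hc.inv_sqrt fun x => hδ.trans_le (p x)).intervalIntegrable (μ := MeasureTheory.volume) 0 1)
    intervalIntegrable_const
    (fun x => inv_anti₀ (Real.sqrt_pos.2 hδ) (Real.sqrt_le_sqrt (p x)))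
  simpa [invSqrtMean] using this

/-- The family `w + s (w - μ)`. -/
def dilate (w : ℝ → ℝ) (μ s : ℝ) : ℝ → ℝ := fun ξ => w ξ + s * (w ξ - μ)

section

variable {w : ℝ → ℝ} {μ s s' c : ℝ}

/-- Up to the factor `1 + s`, the perturbation only shifts the level. Integrals for the perturbed
potential thereby reduce to integrals for `w`, which `exists_weighted_mean` controls. -/
theorem dilate_add (hs : 0 ≤ s) (ξ : ℝ) :
    dilate w μ s ξ + c = (1 + s) * (w ξ + (c - s * μ) / (1 + s)) := by
  have : (1 + s) ≠ 0 := by positivity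
  rw [dilate]
  field_simp
  ring

theorem Continuous.dilate (hw : Continuous w) : Continuous (dilate w μ s) :=
  hw.add (continuous_const.mul (hw.sub continuous_const))

theorem invSqrtMean_dilate_add (hs : 0 ≤ s) :
    invSqrtMean (fun ξ => dilate w μ s ξ + c) =
      (√(1 + s))⁻¹ * invSqrtMean (fun ξ => w ξ + (c - s * μ) / (1 + s)) := by
  rw [invSqrtMean, invSqrtMean, ← intervalIntegral.integral_const_mul]
  refine intervalIntegral.integral_congr fun ξ _ => ?_
  simp only [dilate_add hs]
  rw [Real.sqrt_mul (by positivity), mul_inv]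

theorem integral_sub_mul_dilate_add (hs : 0 ≤ s) :
    ∫ ξ in (0 : ℝ)..1, (w ξ - μ) * (√(dilate w μ s ξ + c))⁻¹ =
      (√(1 + s))⁻¹ * ∫ ξ in (0 : ℝ)..1, (w ξ - μ) * (√(w ξ + (c - s * μ) / (1 + s)))⁻¹ := by
  rw [← intervalIntegral.integral_const_mul]
  refine intervalIntegral.integral_congr fun ξ _ => ?_
  simp only [dilate_add hs]
  rw [Real.sqrt_mul (by positivity), mul_inv]
  ring

theorem sqrtMean_dilate_sub_le (hw : Continuous w) (hs : 0 ≤ s)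
    (h : ∀ ξ, 0 < dilate w μ s ξ + c) (h' : ∀ ξ, 0 ≤ dilate w μ s' ξ + c) :
    sqrtMean (fun ξ => dilate w μ s' ξ + c) - sqrtMean (fun ξ => dilate w μ s ξ + c) ≤
      (s' - s) / 2 * ((√(1 + s))⁻¹ *
        ∫ ξ in (0 : ℝ)..1, (w ξ - μ) * (√(w ξ + (c - s * μ) / (1 + s)))⁻¹) := by
  refine (sqrtMean_sub_le (h₀ := fun ξ => dilate w μ s ξ + c) (h₁ := fun ξ => dilate w μ s' ξ + c)
    (hw.dilate.add continuous_const) (hw.dilate.add continuous_const) h h').trans (le_of_eq ?_)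
  rw [← integral_sub_mul_dilate_add hs, ← intervalIntegral.integral_const_mul,
    ← intervalIntegral.integral_div]
  refine intervalIntegral.integral_congr fun ξ _ => ?_
  simp only [dilate]
  ring

end

section

variable {u w : ℝ → ℝ}

/-- Critical levels stay below any number above the critical level of the unperturbed pair. -/
theorem critical_level_le (hu : Continuous u) (hw : Continuous w) {M N c₀ c₁ c s μ : ℝ} (hM : 0 < M)
    (hN : 0 ≤ N) (hs : 0 ≤ s) (hcw₀ : ∀ ξ, 0 < w ξ + c₀)
    (hcrit₀ : M * invSqrtMean (fun ξ => u ξ - c₀) = N * invSqrtMean (fun ξ => w ξ + c₀))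
    (h01 : c₀ < c₁) (hs₁ : c₀ ≤ (c₁ - s * μ) / (1 + s)) (hcu : ∀ ξ, c < u ξ)
    (hcrit : M * invSqrtMean (fun ξ => u ξ - c) = N * invSqrtMean (fun ξ => dilate w μ s ξ + c)) :
    c ≤ c₁ := by
  by_contra! hlt
  have p₁ : ∀ ξ, 0 < dilate w μ s ξ + c₁ := fun ξ => by
    rw [dilate_add hs]
    have := hcw₀ ξ
    have h1 : 0 < w ξ + (c₁ - s * μ) / (1 + s) := by linarith
    positivity
  -- Raising the level past `c₁` cannot lengthen the `y`-rotation but strictly lengthens the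
  -- `x`-rotation, so the two periods can no longer agree.
  have h1 : invSqrtMean (fun ξ => dilate w μ s ξ + c) ≤ invSqrtMean (fun ξ => w ξ + c₀) := by
    have a1 : invSqrtMean (fun ξ => dilate w μ s ξ + c) ≤
        invSqrtMean (fun ξ => dilate w μ s ξ + c₁) :=
      invSqrtMean_le (hw.dilate.add continuous_const) (hw.dilate.add continuous_const) p₁
        fun ξ => by linarith
    have a2 : invSqrtMean (fun ξ => w ξ + (c₁ - s * μ) / (1 + s)) ≤
        invSqrtMean (fun ξ => w ξ + c₀) :=
      invSqrtMean_le (hw.add continuous_const) (hw.add continuous_const) hcw₀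
        fun ξ => by linarith
    have a3 : (√(1 + s))⁻¹ ≤ 1 := inv_le_one_of_one_le₀ (Real.one_le_sqrt.2 (by linarith))
    rw [invSqrtMean_dilate_add (c := c₁) hs] at a1
    have a4 : 0 < invSqrtMean (fun ξ => w ξ + (c₁ - s * μ) / (1 + s)) :=
      invSqrtMean_pos (hw.add continuous_const) fun ξ => by linarith [hcw₀ ξ]
    nlinarith
  have h2 : invSqrtMean (fun ξ => u ξ - c₀) < invSqrtMean (fun ξ => u ξ - c) :=
    invSqrtMean_lt (hu.sub continuous_const) (hu.sub continuous_const)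
      (fun ξ => by linarith [hcu ξ]) fun ξ => by linarith
  have h3 := mul_lt_mul_of_pos_left h2 hM
  have h4 := mul_le_mul_of_nonneg_left h1 hN
  linarith

-- The core of the density argument. Along the family the rotational action does not increase,
-- whereas an oscillatory action would increase linearly in `s` but for an error quadratic in the
-- displacement of the turning point. Coincidence at every small `s` contradicts
-- `exists_lt_of_sq_control`.
set_option maxHeartbeats 1000000 in
theorem exists_dilate_disjoint (hu : ContDiff ℝ 2 u) (hw : ContDiff ℝ 2 w)
    (pu : Function.Periodic u 1) (pw : Function.Periodic w 1) (hpos : ∀ ξ η, 0 < u ξ + w η)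
    (hnc : ∃ ξ η, w ξ ≠ w η) {m n : ℤ} (hm : m ≠ 0) (hn : n ≠ 0) (n' : ℤ) :
    ∃ μ, ∀ ε > 0, ∃ s ∈ Ico 0 ε, Disjoint (separatedSpectrum u (dilate w μ s) m n)
      (separatedSpectrum u (dilate w μ s) 0 n') := by
  by_cases hdis : Disjoint (separatedSpectrum u w m n) (separatedSpectrum u w 0 n')
  · refine ⟨0, fun ε hε => ⟨0, ⟨le_rfl, hε⟩, ?_⟩⟩
    have : dilate w 0 0 = w := by funext ξ; simp [dilate]
    rwa [this]
  obtain ⟨ℓ, hℓ, hℓ'⟩ := not_disjoint_iff.1 hdis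
  obtain ⟨c₀, hc₀u, hc₀w, hcrit₀, -⟩ := exists_level_of_mem_separatedSpectrum hu hw pu pw hm hn hℓ
  obtain ⟨hn', -⟩ := exists_turning_point_of_mem_separatedSpectrum hu hw pu pw hpos hℓ'
  clear hℓ hℓ' hdis
  have cw := hw.continuous
  have cu := hu.continuous
  obtain ⟨b, hb, hbw⟩ : ∃ b, (∀ ξ, b ≤ u ξ) ∧ c₀ < b := by
    obtain ⟨y, ⟨ξ, rfl⟩, hy⟩ := (pu.compact_of_continuous one_ne_zero cu).exists_isLeast
      (range_nonempty u)
    exact ⟨u ξ, fun η => hy (mem_range_self η), hc₀u ξ⟩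
  obtain ⟨K, hK, bu⟩ := exists_c2Bound hu pu
  have hKb : ∀ ξ, u ξ ≤ K := fun ξ => (le_abs_self _).trans (bu.abs_le ξ)
  -- The levels are ordered `c₀ < c₁ < e₀ < e₁ < b`. Perturbed critical levels stay below `c₁`, the
  -- weight is taken at `e₀`, and the levels of turning points, after the shift in `dilate_add`,
  -- stay above `e₁`. The gaps absorb the shifts for small `s`.
  set e₀ := (c₀ + b) / 2 with he₀
  set c₁ := (c₀ + e₀) / 2 with hc₁
  set e₁ := (e₀ + b) / 2 with he₁
  obtain ⟨μ, hμpos, hneg, hposκ⟩ := exists_weighted_mean cw pw hnc (e₀ := e₀)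
    (fun ξ => by linarith [hc₀w ξ])
  obtain ⟨η, hη, hηle⟩ := hposκ e₁ (by linarith) (K + |μ|)
  obtain ⟨ε₁, hε₁, hsmall⟩ : ∃ ε₁ > 0, ∀ s, 0 ≤ s → s ≤ ε₁ → s ≤ 1 ∧ c₀ ≤ (c₁ - s * μ) / (1 + s) ∧
      (c₁ - s * μ) / (1 + s) ≤ e₀ ∧ e₁ ≤ (b - s * μ) / (1 + s) := by
    have hcont : ∀ c : ℝ, Tendsto (fun s : ℝ => (c - s * μ) / (1 + s)) (𝓝 0) (𝓝 c) := fun c => by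
      have : ContinuousAt (fun s : ℝ => (c - s * μ) / (1 + s)) 0 := by
        refine ContinuousAt.div (by fun_prop) (by fun_prop) (by norm_num)
      simpa [ContinuousAt] using this
    have h1 := (hcont c₁).eventually_const_lt (show c₀ < c₁ by linarith)
    have h2 := (hcont c₁).eventually_lt_const (show c₁ < e₀ by linarith)
    have h3 := (hcont b).eventually_const_lt (show e₁ < b by linarith)
    have h4 : ∀ᶠ s : ℝ in 𝓝 0, s < 1 := eventually_lt_nhds one_pos
    obtain ⟨ε, hε, H⟩ := Metric.eventually_nhds_iff.1 (h1.and (h2.and (h3.and h4)))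
    refine ⟨ε / 2, by positivity, fun s hs hsε => ?_⟩
    obtain ⟨a1, a2, a3, a4⟩ := H (y := s) (by rw [Real.dist_0_eq_abs, abs_of_nonneg hs]; linarith)
    exact ⟨a4.le, a1.le, a2.le, a3.le⟩
  obtain ⟨δ, hδ, hδw⟩ : ∃ δ > 0, ∀ ξ, δ ≤ w ξ + e₁ := by
    obtain ⟨y, ⟨ξ, rfl⟩, hy⟩ := (pw.compact_of_continuous one_ne_zero cw).exists_isLeast
      (range_nonempty w)
    exact ⟨w ξ + e₁, by linarith [hc₀w ξ], fun η => by linarith [hy (mem_range_self η)]⟩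
  obtain ⟨D, hD, hDw⟩ : ∃ D, 0 ≤ D ∧ ∀ ξ, |w ξ - μ| ≤ D := by
    obtain ⟨K', hK', bw⟩ := exists_c2Bound hw pw
    refine ⟨K' + |μ|, by positivity, fun ξ => (abs_sub _ _).trans ?_⟩
    gcongr
    exact bw.abs_le ξ
  have hlow : ∀ s, 0 ≤ s → s ≤ ε₁ → ∀ a, e₁ ≤ (u a - s * μ) / (1 + s) := fun s hs hsε a =>
    (hsmall s hs hsε).2.2.2.trans (by gcongr; exact hb a)
  have hδs : ∀ s, 0 ≤ s → s ≤ ε₁ → ∀ a ξ, δ ≤ dilate w μ s ξ + u a := fun s hs hsε a ξ => by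
    rw [dilate_add hs]
    have h1 := hlow s hs hsε a
    have h2 := hδw ξ
    nlinarith
  -- regularity of the family
  have hWc : ∀ s, ContDiff ℝ 2 (dilate w μ s) := fun s =>
    hw.add (contDiff_const.mul (hw.sub contDiff_const))
  have hWp : ∀ s, Function.Periodic (dilate w μ s) 1 := fun s ξ => by simp only [dilate, pw ξ]
  -- the rotational action is nonincreasing
  have hanti : ∀ s s', 0 ≤ s → s < s' → s' ≤ ε₁ →
      ∀ ℓ ∈ separatedSpectrum u (dilate w μ s) m n, ∀ ℓ' ∈ separatedSpectrum u (dilate w μ s') m n,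
      ℓ' ≤ ℓ := by
    intro s s' hs hss hsε ℓ hℓ ℓ' hℓ'
    obtain ⟨c, hcu, hcw, hcrit, rfl⟩ :=
      exists_level_of_mem_separatedSpectrum hu (hWc s) pu (hWp s) hm hn hℓ
    obtain ⟨c', hcu', hcw', hcrit', rfl⟩ :=
      exists_level_of_mem_separatedSpectrum hu (hWc s') pu (hWp s') hm hn hℓ'
    have hs' : 0 ≤ s' := hs.trans hss.le
    have hle : c' ≤ c₁ := critical_level_le cu cw (abs_pos.2 (by exact_mod_cast hm)) (abs_nonneg _)
      hs' hc₀w hcrit₀ (by linarith) (hsmall s' hs' hsε).2.1 hcu' hcrit'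
    have hμc : 0 < μ + c' := by
      have h1 := hμpos ((c' - s' * μ) / (1 + s')) fun ξ => by
        have := hcw' ξ
        rw [dilate_add hs'] at this
        exact (pos_iff_pos_of_mul_pos this).1 (by positivity)
      have h2 : μ + c' = (1 + s') * (μ + (c' - s' * μ) / (1 + s')) := by
        field_simp
        ring
      rw [h2]
      positivity
    -- The later critical level is admissible at the earlier parameter: where `w ≤ μ`, decreasing
    -- `s` raises the potential, and elsewhere it is at least `μ`, with `μ + c' > 0`.
    have hadm : ∀ ξ, 0 < dilate w μ s ξ + c' := fun ξ => by
      have := hcw' ξ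
      simp only [dilate] at this ⊢
      rcases le_total (w ξ) μ with h | h <;> nlinarith
    -- The action at `s` dominates its value at the noncritical level `c'`, which in turn dominates
    -- the action at `s'` and `c'` because that level is below `e₀`.
    have h1 := le_of_critical_level cu (hWc s).continuous (abs_nonneg _) (abs_nonneg _) hcu hcw hcrit
      (fun ξ => (hcu' ξ).le) fun ξ => (hadm ξ).le
    have h2 := sqrtMean_dilate_sub_le (s' := s') cw hs hadm fun ξ => (hcw' ξ).le
    have h3 := hneg ((c' - s * μ) / (1 + s))
      (le_trans (by gcongr) (hsmall s hs (hss.le.trans hsε)).2.2.1) fun ξ => by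
        have := hadm ξ
        rw [dilate_add hs] at this
        exact (pos_iff_pos_of_mul_pos this).1 (by positivity)
    have h4 : sqrtMean (fun ξ => dilate w μ s' ξ + c') ≤ sqrtMean (fun ξ => dilate w μ s ξ + c') := by
      have : (s' - s) / 2 * ((√(1 + s))⁻¹ *
          ∫ ξ in (0 : ℝ)..1, (w ξ - μ) * (√(w ξ + (c' - s * μ) / (1 + s)))⁻¹) ≤ 0 :=
        mul_nonpos_of_nonneg_of_nonpos (by linarith)
          (mul_nonpos_of_nonneg_of_nonpos (by positivity) h3)
      linarith
    have h5 := mul_le_mul_of_nonneg_left h4 (abs_nonneg (n : ℝ))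
    linarith
  -- the oscillatory actions increase
  have hgrow : ∀ s s', 0 ≤ s → s < s' → s' ≤ ε₁ → ∀ a, η / 4 * (s' - s) ≤
      sqrtMean (fun ξ => dilate w μ s' ξ + u a) - sqrtMean (fun ξ => dilate w μ s ξ + u a) := by
    intro s s' hs hss hsε a
    have hs' : 0 ≤ s' := hs.trans hss.le
    -- The tangent is taken at the later parameter, so that concavity gives a lower bound for the
    -- growth.
    have h1 := sqrtMean_dilate_sub_le (s' := s) (s := s') (c := u a) cw hs'
      (fun ξ => hδ.trans_le (hδs s' hs' hsε a ξ))
      (fun ξ => (hδ.trans_le (hδs s hs (hss.le.trans hsε) a ξ)).le)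
    have h2 := hηle _ (hlow s' hs' hsε a) (by
      rw [div_le_iff₀ (by positivity)]
      have t1 : -(s' * μ) ≤ s' * |μ| := by nlinarith [neg_abs_le μ]
      nlinarith [hKb a, abs_nonneg μ, mul_nonneg hs' hK.le, (hsmall s' hs' hsε).1])
    have h3 : (1 : ℝ) / 2 ≤ (√(1 + s'))⁻¹ := by
      rw [one_div]
      refine inv_anti₀ (Real.sqrt_pos.2 (by positivity)) ?_
      rw [Real.sqrt_le_left (by norm_num)]
      linarith [(hsmall s' hs' hsε).1]
    have h4 : 1 / 2 * η ≤ (√(1 + s'))⁻¹ *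
        ∫ ξ in (0 : ℝ)..1, (w ξ - μ) * (√(w ξ + (u a - s' * μ) / (1 + s')))⁻¹ :=
      mul_le_mul h3 h2 hη.le (by positivity)
    nlinarith
  set N : ℝ := |(n' : ℝ)| with hN
  have hNpos : 0 < N := abs_pos.2 (by exact_mod_cast hn')
  set Λ : ℝ := (√δ)⁻¹ ^ 3 with hΛ
  have hΛ0 : 0 ≤ Λ := by positivity
  obtain ⟨C, hC, hvar⟩ := exists_action_variation bu (R := N * (√δ)⁻¹) (by positivity)
  -- The summands account for the mixed term in displacement and parameter, for the libration
  -- remainder in the displacement, and for its remainder in `Q' - Q`.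
  set C' := N * Λ * D * K + C + 2 * C * (N * Λ) ^ 2 * (K ^ 2 + D ^ 2) with hC'
  have hC'0 : 0 ≤ C' := by positivity
  -- quadratic control of coincidences
  have hquad : ∀ s s', 0 ≤ s → s < s' → s' ≤ ε₁ → ∀ ℓ ℓ' : ℝ, ℓ' ≤ ℓ →
      ∀ x v x' v' : ℝ → ℝ, ∀ Q Q' : ℝ, 0 < Q → 0 < Q' → NewtonSolution u x v → NewtonSolution u x' v' →
      v 0 = 0 → v' 0 = 0 → v Q = 0 → v' Q' = 0 →
      Q = N * invSqrtMean (fun ξ => dilate w μ s ξ + u (x 0)) →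
      Q' = N * invSqrtMean (fun ξ => dilate w μ s' ξ + u (x' 0)) →
      ℓ = (∫ t in (0 : ℝ)..Q, v t ^ 2) + N * sqrtMean (fun ξ => dilate w μ s ξ + u (x 0)) →
      ℓ' = (∫ t in (0 : ℝ)..Q', v' t ^ 2) + N * sqrtMean (fun ξ => dilate w μ s' ξ + u (x' 0)) →
      N * η / 4 * (s' - s) ≤ C' * ((x' 0 - x 0) ^ 2 + (s' - s) ^ 2) := by
    intro s s' hs hss hsε ℓ ℓ' hle x v x' v' Q Q' hQ hQ' hx hx' i i' f f' eQ eQ' eℓ eℓ'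
    have hs' : 0 ≤ s' := hs.trans hss.le
    have hsε' : s ≤ ε₁ := hss.le.trans hsε
    have cd : ∀ r a, Continuous fun ξ => dilate w μ r ξ + u a := fun r a =>
      cw.dilate.add continuous_const
    have hQR : Q ≤ N * (√δ)⁻¹ := by
      rw [eQ]; gcongr; exact invSqrtMean_le_inv_sqrt (cd _ _) hδ (hδs s hs hsε' _)
    have hQR' : Q' ≤ N * (√δ)⁻¹ := by
      rw [eQ']; gcongr; exact invSqrtMean_le_inv_sqrt (cd _ _) hδ (hδs s' hs' hsε _)
    have h1 := (abs_le.1 (hvar x v x' v' Q Q' hx hx' hQ.le hQR hQ'.le hQR' i i' f f')).1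
    have h2 := hgrow s s' hs hss hsε (x' 0)
    have h3 := sqrtMean_add_sub_le (h := dilate w μ s) cw.dilate (c := u (x' 0)) (c' := u (x 0))
      (fun ξ => hδ.trans_le (hδs s hs hsε' _ ξ)) (fun ξ => (hδ.trans_le (hδs s hs hsε' _ ξ)).le)
    have hcu := bu.abs_sub_le (x' 0) (x 0)
    have hds : ∀ ξ, |s' * (w ξ - μ) - s * (w ξ - μ)| ≤ D * (s' - s) := fun ξ => by
      rw [← sub_mul, abs_mul, abs_of_pos (by linarith : (0 : ℝ) < s' - s), mul_comm]
      gcongr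
      exact hDw ξ
    have h4 : |invSqrtMean (fun ξ => dilate w μ s' ξ + u (x' 0)) -
        invSqrtMean (fun ξ => dilate w μ s ξ + u (x' 0))| ≤ Λ * (D * (s' - s)) :=
      abs_invSqrtMean_sub_le (cd _ _) (cd _ _) hδ (hδs s hs hsε' _) (hδs s' hs' hsε _) fun ξ => by
        refine le_trans (le_of_eq ?_) (hds ξ)
        simp only [dilate]
        congr 1
        ring
    have h5 : |invSqrtMean (fun ξ => dilate w μ s' ξ + u (x' 0)) -
        invSqrtMean (fun ξ => dilate w μ s ξ + u (x 0))| ≤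
        Λ * (K * |x' 0 - x 0| + D * (s' - s)) :=
      abs_invSqrtMean_sub_le (cd _ _) (cd _ _) hδ (hδs s hs hsε' _) (hδs s' hs' hsε _) fun ξ => by
        refine le_trans (le_of_eq ?_) ((abs_add_le _ _).trans (add_le_add hcu (hds ξ)))
        simp only [dilate]
        congr 1
        ring
    set α := |x' 0 - x 0| with hα
    have hα2 : (x' 0 - x 0) ^ 2 = α ^ 2 := (sq_abs _).symm
    have hα0 : 0 ≤ α := abs_nonneg _
    set σ := s' - s with hσ
    have hσ0 : 0 < σ := by linarith
    have hQQ : (Q' - Q) ^ 2 ≤ 2 * (N * Λ) ^ 2 * (K ^ 2 + D ^ 2) * (α ^ 2 + σ ^ 2) := by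
      have g1 : |Q' - Q| ≤ N * Λ * (K * α + D * σ) := by
        rw [eQ, eQ', ← mul_sub, abs_mul, abs_of_pos hNpos, mul_assoc]
        gcongr
      have g2 : (Q' - Q) ^ 2 ≤ (N * Λ * (K * α + D * σ)) ^ 2 := by
        rw [← sq_abs]; gcongr
      have g3 : (K * α + D * σ) ^ 2 ≤ 2 * (K ^ 2 + D ^ 2) * (α ^ 2 + σ ^ 2) := by
        have k1 := sq_nonneg (K * σ - D * α)
        have k2 : 0 ≤ (K ^ 2 + D ^ 2) * (α ^ 2 + σ ^ 2) := by positivity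
        linarith
      have g4 := mul_le_mul_of_nonneg_left g3 (sq_nonneg (N * Λ))
      calc (Q' - Q) ^ 2 ≤ (N * Λ) ^ 2 * (K * α + D * σ) ^ 2 := by rw [← mul_pow]; exact g2
        _ ≤ _ := g4
        _ = _ := by ring
    -- The terms linear in `u (x' 0) - u (x 0)` have coefficients `-Q' / 2` from the libration and
    -- half the `y`-period at `s` from the rotation. Since `Q'` is the `y`-period at `s'` for the
    -- same level, only a mixed term survives.
    have h6 : -(K * α * (N * Λ * D * σ)) ≤ (u (x' 0) - u (x 0)) *
        (N * invSqrtMean (fun ξ => dilate w μ s ξ + u (x' 0)) - Q') := by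
      rw [eQ', ← mul_sub]
      refine neg_le_of_abs_le ?_
      rw [abs_mul, abs_mul, abs_of_pos hNpos, abs_sub_comm (invSqrtMean _)]
      calc |u (x' 0) - u (x 0)| * (N * _) ≤ (K * α) * (N * (Λ * (D * σ))) := by gcongr
        _ = _ := by ring
    have h7 : α * σ ≤ α ^ 2 + σ ^ 2 := by
      linarith [sq_nonneg (α - σ), sq_nonneg α, sq_nonneg σ]
    have h8 := mul_le_mul_of_nonneg_left h7 (by positivity : 0 ≤ N * Λ * D * K)
    have h9 := mul_le_mul_of_nonneg_left hQQ hC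
    have h2N := mul_le_mul_of_nonneg_left h2 hNpos.le
    have h3N := mul_le_mul_of_nonneg_left h3 hNpos.le
    rw [hα2] at h1 ⊢
    have h10 : 0 ≤ N * Λ * D * K * (α * σ) := by positivity
    have h11 : 0 ≤ C * σ ^ 2 := by positivity
    rw [hC']
    linear_combination hle + h1 + h2N + h3N + h6 / 2 + h8 + h9 + h10 / 2 - eℓ' + eℓ + h11
  refine ⟨μ, fun ε hε => ?_⟩
  by_contra! hcon
  have hκ : 0 < N * η / 8 := by positivity
  -- The last bound makes `C' * (s' - s) ^ 2` at most half of the linear gain; the pigeonhole makes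
  -- the displacement term smaller than the other half.
  set ε₂ := min (ε / 2) (min ε₁ (N * η / 8 / (C' + 1))) with hε₂
  have hε₂0 : 0 < ε₂ := by positivity
  have hbad : ∀ s ∈ Icc 0 ε₂, ∃ a ∈ Icc (0 : ℝ) 1, ∃ (ℓ : ℝ) (x v : ℝ → ℝ) (Q : ℝ),
      ℓ ∈ separatedSpectrum u (dilate w μ s) m n ∧ 0 < Q ∧ NewtonSolution u x v ∧ x 0 = a ∧ v 0 = 0 ∧
      v Q = 0 ∧ Q = N * invSqrtMean (fun ξ => dilate w μ s ξ + u (x 0)) ∧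
      ℓ = (∫ t in (0 : ℝ)..Q, v t ^ 2) + N * sqrtMean (fun ξ => dilate w μ s ξ + u (x 0)) := by
    intro s hs
    have hsε : s ≤ ε / 2 := hs.2.trans (min_le_left _ _)
    have hsε₁ : s ≤ ε₁ := hs.2.trans ((min_le_right _ _).trans (min_le_left _ _))
    obtain ⟨ℓ, hℓ, hℓ'⟩ := not_disjoint_iff.1 (hcon s ⟨hs.1, by linarith⟩)
    obtain ⟨-, x, v, Q, hQ, hx, ha, hv, -, hvQ, eQ, eℓ⟩ :=
      exists_turning_point_of_mem_separatedSpectrum hu (hWc s) pu (hWp s)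
        (fun ξ ζ => by linarith [hδs s hs.1 hsε₁ ξ ζ]) hℓ'
    exact ⟨x 0, ha, ℓ, x, v, Q, hℓ, hQ, hx, rfl, hv, hvQ, eQ, eℓ⟩
  choose! a ha ℓ x v Q hℓ hQ hx hxa hv hvQ eQ eℓ using hbad
  obtain ⟨s, hs, s', hs', hss, hlt⟩ := exists_lt_of_sq_control (C := C' / (N * η / 8)) hε₂0 a ha
  have hsε₁ : s' ≤ ε₁ := hs'.2.trans ((min_le_right _ _).trans (min_le_left _ _))
  have h1 := hquad s s' hs.1 hss hsε₁ (ℓ s) (ℓ s')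
    (hanti s s' hs.1 hss hsε₁ _ (hℓ s hs) _ (hℓ s' hs')) _ _ _ _ _ _ (hQ s hs) (hQ s' hs') (hx s hs)
    (hx s' hs') (hv s hs) (hv s' hs') (hvQ s hs) (hvQ s' hs') (eQ s hs) (eQ s' hs') (eℓ s hs)
    (eℓ s' hs')
  rw [hxa s hs, hxa s' hs'] at h1
  have h2 : C' * (s' - s) ≤ N * η / 8 := by
    have : s' - s ≤ N * η / 8 / (C' + 1) :=
      (by linarith [hs.1] : s' - s ≤ s').trans
        (hs'.2.trans ((min_le_right _ _).trans (min_le_right _ _)))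
    rw [le_div_iff₀ (by positivity)] at this
    nlinarith
  have h3 : C' * (s' - s) ^ 2 ≤ N * η / 8 * (s' - s) := by
    rw [sq, ← mul_assoc]
    exact mul_le_mul_of_nonneg_right h2 (by linarith)
  rw [div_mul_eq_mul_div, div_lt_iff₀ hκ] at hlt
  linarith

end

/-! ### Geodesics of Liouville metrics in Hamiltonian form -/

/-- The Hamiltonian equations of the unit speed geodesics of `(u(x) + w(y)) (dx² + dy²)`, with
momenta `p` and `q`. -/
structure HamiltonOrbit (u w x p y q : ℝ → ℝ) : Prop where
  hasDerivAt_x : ∀ t, HasDerivAt x (p t / (u (x t) + w (y t))) t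
  hasDerivAt_p : ∀ t, HasDerivAt p (deriv u (x t) / 2 / (u (x t) + w (y t))) t
  hasDerivAt_y : ∀ t, HasDerivAt y (q t / (u (x t) + w (y t))) t
  hasDerivAt_q : ∀ t, HasDerivAt q (deriv w (y t) / 2 / (u (x t) + w (y t))) t
  energy : ∀ t, p t ^ 2 + q t ^ 2 = u (x t) + w (y t)

theorem contDiff_one_of_hasDerivAt {f f' : ℝ → ℝ} (h : ∀ t, HasDerivAt f (f' t) t)
    (hf' : Continuous f') : ContDiff ℝ 1 f := by
  refine contDiff_one_iff_deriv.2 ⟨fun t => (h t).differentiableAt, ?_⟩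
  rwa [show deriv f = f' from funext fun t => (h t).deriv]

theorem contDiff_two_of_hasDerivAt {f f' : ℝ → ℝ} (h : ∀ t, HasDerivAt f (f' t) t)
    (hf' : ContDiff ℝ 1 f') : ContDiff ℝ 2 f := by
  rw [show (2 : WithTop ℕ∞) = 1 + 1 by norm_num, contDiff_succ_iff_deriv]
  refine ⟨fun t => (h t).differentiableAt, by simp, ?_⟩
  rwa [show deriv f = f' from funext fun t => (h t).deriv]

theorem liouvilleMetric_hasFDerivAt {f₁ f₂ : ℝ → ℝ} (h₁ : ContDiff ℝ 2 f₁)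
    (h₂ : ContDiff ℝ 2 f₂) (x : Fin 2 → ℝ) :
    HasFDerivAt (fun y : Fin 2 → ℝ => 1 + f₁ (y 0) + f₂ (y 1))
      (deriv f₁ (x 0) • ContinuousLinearMap.proj (R := ℝ) (φ := fun _ : Fin 2 => ℝ) 0 +
        deriv f₂ (x 1) • ContinuousLinearMap.proj (R := ℝ) (φ := fun _ : Fin 2 => ℝ) 1) x := by
  have a1 := ((h₁.differentiable (by norm_num)) (x 0)).hasDerivAt.comp_hasFDerivAt x
    (hasFDerivAt_apply (𝕜 := ℝ) 0 x)
  have a2 := ((h₂.differentiable (by norm_num)) (x 1)).hasDerivAt.comp_hasFDerivAt x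
    (hasFDerivAt_apply (𝕜 := ℝ) 1 x)
  exact (a1.const_add 1).add a2

section

variable {f₁ f₂ : ℝ → ℝ} (h₁ : ContDiff ℝ 2 f₁) (h₂ : ContDiff ℝ 2 f₂)
  (p₁ : Function.Periodic f₁ 1) (p₂ : Function.Periodic f₂ 1) (hpos : ∀ x₁ x₂, -1 < f₁ x₁ + f₂ x₂)

theorem liouvilleMetric_normSq (x v : Fin 2 → ℝ) :
    (liouvilleMetric f₁ f₂ h₁ h₂ p₁ p₂ hpos).normSq x v =
      (1 + f₁ (x 0) + f₂ (x 1)) * (v 0 ^ 2 + v 1 ^ 2) := by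
  simp [TorusMetric.normSq, liouvilleMetric, Fin.sum_univ_two, Matrix.diagonal]
  ring

theorem liouvilleMetric_momentum (x v : Fin 2 → ℝ) (k : Fin 2) :
    ∑ j, (liouvilleMetric f₁ f₂ h₁ h₂ p₁ p₂ hpos).coeff x k j * v j =
      (1 + f₁ (x 0) + f₂ (x 1)) * v k := by
  fin_cases k <;> simp [liouvilleMetric, Matrix.diagonal]

theorem liouvilleMetric_force (x v : Fin 2 → ℝ) (k : Fin 2) :
    ∑ i, ∑ j, (liouvilleMetric f₁ f₂ h₁ h₂ p₁ p₂ hpos).partialCoeff k i j x * v i * v j =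
      ![deriv f₁ (x 0), deriv f₂ (x 1)] k * (v 0 ^ 2 + v 1 ^ 2) := by
  have hd := (liouvilleMetric_hasFDerivAt h₁ h₂ x).fderiv
  fin_cases k <;>
  · simp [TorusMetric.partialCoeff, liouvilleMetric, Fin.sum_univ_two, Matrix.diagonal, hd]
    ring

theorem HamiltonOrbit.isUnitSpeedGeodesic {x p y q : ℝ → ℝ}
    (h : HamiltonOrbit (fun ξ => 1 + f₁ ξ) f₂ x p y q) :
    (liouvilleMetric f₁ f₂ h₁ h₂ p₁ p₂ hpos).IsUnitSpeedGeodesic (fun t => ![x t, y t]) := by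
  have hV : ∀ t, 0 < 1 + f₁ (x t) + f₂ (y t) := fun t => by linarith [hpos (x t) (y t)]
  have cx : Continuous x := continuous_iff_continuousAt.2 fun t => (h.hasDerivAt_x t).continuousAt
  have cy : Continuous y := continuous_iff_continuousAt.2 fun t => (h.hasDerivAt_y t).continuousAt
  have cp : Continuous p := continuous_iff_continuousAt.2 fun t => (h.hasDerivAt_p t).continuousAt
  have cq : Continuous q := continuous_iff_continuousAt.2 fun t => (h.hasDerivAt_q t).continuousAt
  have c1 := h₁.continuous
  have c2 := h₂.continuous
  have c1' : Continuous (deriv fun ξ => 1 + f₁ ξ) :=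
    (contDiff_const.add h₁).continuous_deriv (by norm_num)
  have c2' : Continuous (deriv f₂) := h₂.continuous_deriv (by norm_num)
  have cV : Continuous fun t => 1 + f₁ (x t) + f₂ (y t) := by fun_prop
  have x1 : ContDiff ℝ 1 x := contDiff_one_of_hasDerivAt h.hasDerivAt_x
    (cp.div cV fun t => (hV t).ne')
  have y1 : ContDiff ℝ 1 y := contDiff_one_of_hasDerivAt h.hasDerivAt_y
    (cq.div cV fun t => (hV t).ne')
  have pc1 : ContDiff ℝ 1 p := contDiff_one_of_hasDerivAt h.hasDerivAt_p
    (((c1'.comp cx).div_const 2).div cV fun t => (hV t).ne')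
  have qc1 : ContDiff ℝ 1 q := contDiff_one_of_hasDerivAt h.hasDerivAt_q
    (((c2'.comp cy).div_const 2).div cV fun t => (hV t).ne')
  have V1 : ContDiff ℝ 1 fun t => 1 + f₁ (x t) + f₂ (y t) :=
    (contDiff_const.add ((h₁.of_le (by norm_num)).comp x1)).add ((h₂.of_le (by norm_num)).comp y1)
  have x2 : ContDiff ℝ 2 x := contDiff_two_of_hasDerivAt h.hasDerivAt_x
    (pc1.div V1 fun t => (hV t).ne')
  have y2 : ContDiff ℝ 2 y := contDiff_two_of_hasDerivAt h.hasDerivAt_y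
    (qc1.div V1 fun t => (hV t).ne')
  have hγ : ∀ t, HasDerivAt (fun t => ![x t, y t])
      ![p t / (1 + f₁ (x t) + f₂ (y t)), q t / (1 + f₁ (x t) + f₂ (y t))] t := fun t => by
    rw [hasDerivAt_pi]
    intro i
    fin_cases i
    · simpa using h.hasDerivAt_x t
    · simpa using h.hasDerivAt_y t
  have hd : ∀ t, deriv (fun t => ![x t, y t]) t =
      ![p t / (1 + f₁ (x t) + f₂ (y t)), q t / (1 + f₁ (x t) + f₂ (y t))] := fun t => (hγ t).deriv
  have hsq : ∀ t, (p t / (1 + f₁ (x t) + f₂ (y t))) ^ 2 + (q t / (1 + f₁ (x t) + f₂ (y t))) ^ 2 =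
      (1 + f₁ (x t) + f₂ (y t))⁻¹ := fun t => by
    rw [div_pow, div_pow, ← add_div, h.energy t]
    have := (hV t).ne'
    field_simp
  refine ⟨?_, fun t => ?_, fun t k => ?_⟩
  · rw [contDiff_pi]
    intro i
    fin_cases i
    · simpa using x2
    · simpa using y2
  · rw [liouvilleMetric_normSq, hd]
    simp only [Matrix.cons_val_zero, Matrix.cons_val_one]
    rw [hsq, mul_inv_cancel₀ (hV t).ne']
  · rw [liouvilleMetric_force]
    simp only [liouvilleMetric_momentum, hd]
    simp only [Matrix.cons_val_zero, Matrix.cons_val_one]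
    rw [hsq]
    have hk : ∀ s, (1 + f₁ (x s) + f₂ (y s)) *
        ![p s / (1 + f₁ (x s) + f₂ (y s)), q s / (1 + f₁ (x s) + f₂ (y s))] k = ![p s, q s] k := by
      intro s
      have := (hV s).ne'
      fin_cases k <;> simp <;> field_simp
    simp only [hk]
    fin_cases k
    · have := (h.hasDerivAt_p t).deriv
      simp only [deriv_const_add'] at this
      simp [this]
      ring
    · have := (h.hasDerivAt_q t).deriv
      simp [this]
      ring

theorem hamiltonOrbit_of_isUnitSpeedGeodesic {γ : ℝ → Fin 2 → ℝ}
    (h : (liouvilleMetric f₁ f₂ h₁ h₂ p₁ p₂ hpos).IsUnitSpeedGeodesic γ) :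
    HamiltonOrbit (fun ξ => 1 + f₁ ξ) f₂ (fun t => γ t 0)
      (fun t => (1 + f₁ (γ t 0) + f₂ (γ t 1)) * deriv γ t 0) (fun t => γ t 1)
      (fun t => (1 + f₁ (γ t 0) + f₂ (γ t 1)) * deriv γ t 1) := by
  have hV : ∀ t, 0 < 1 + f₁ (γ t 0) + f₂ (γ t 1) := fun t => by linarith [hpos (γ t 0) (γ t 1)]
  have hγ : ∀ t, HasDerivAt γ (deriv γ t) t := fun t =>
    (h.contDiff.differentiable (by norm_num) t).hasDerivAt
  have hγi : ∀ t i, HasDerivAt (fun t => γ t i) (deriv γ t i) t := fun t =>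
    hasDerivAt_pi.1 (hγ t)
  have hγ' : ContDiff ℝ 1 (deriv γ) := by
    have : ContDiff ℝ (1 + 1) γ := by simpa [one_add_one_eq_two] using h.contDiff
    exact (contDiff_succ_iff_deriv.1 this).2.2
  have hunit : ∀ t, (1 + f₁ (γ t 0) + f₂ (γ t 1)) * (deriv γ t 0 ^ 2 + deriv γ t 1 ^ 2) = 1 :=
    fun t => by rw [← liouvilleMetric_normSq h₁ h₂ p₁ p₂ hpos]; exact h.unit_speed t
  have hsq : ∀ t, deriv γ t 0 ^ 2 + deriv γ t 1 ^ 2 = (1 + f₁ (γ t 0) + f₂ (γ t 1))⁻¹ := fun t =>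
    eq_inv_of_mul_eq_one_right (hunit t)
  have hγc : ∀ i, ContDiff ℝ 2 fun t => γ t i := contDiff_pi.1 h.contDiff
  have hV2 : ContDiff ℝ 2 fun t => 1 + f₁ (γ t 0) + f₂ (γ t 1) :=
    (contDiff_const.add (h₁.comp (hγc 0))).add (h₂.comp (hγc 1))
  have hp : ∀ t k, HasDerivAt (fun t => (1 + f₁ (γ t 0) + f₂ (γ t 1)) * deriv γ t k)
      (![deriv f₁ (γ t 0), deriv f₂ (γ t 1)] k / 2 / (1 + f₁ (γ t 0) + f₂ (γ t 1))) t := by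
    intro t k
    have hdiff : DifferentiableAt ℝ (fun t => (1 + f₁ (γ t 0) + f₂ (γ t 1)) * deriv γ t k) t :=
      (hV2.differentiable (by norm_num) t).mul
        ((contDiff_pi.1 hγ' k).differentiable (by norm_num) t)
    have := h.geodesic_eq t k
    rw [liouvilleMetric_force, hsq] at this
    simp only [liouvilleMetric_momentum] at this
    refine hdiff.hasDerivAt.congr_deriv (this.trans ?_)
    ring
  refine ⟨fun t => ?_, fun t => ?_, fun t => ?_, fun t => ?_, fun t => ?_⟩
  · rw [mul_div_cancel_left₀ _ (hV t).ne']
    exact hγi t 0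
  · simpa using hp t 0
  · rw [mul_div_cancel_left₀ _ (hV t).ne']
    exact hγi t 1
  · simpa using hp t 1
  · linear_combination (1 + f₁ (γ t 0) + f₂ (γ t 1)) * hunit t

/-- At unit speed the length over a period is the period itself. -/
theorem mem_lengthSpectrum_liouvilleMetric_iff {m n : ℤ} {ℓ : ℝ} :
    ℓ ∈ (liouvilleMetric f₁ f₂ h₁ h₂ p₁ p₂ hpos).lengthSpectrum m n ↔
      0 < ℓ ∧ ∃ x p y q : ℝ → ℝ, HamiltonOrbit (fun ξ => 1 + f₁ ξ) f₂ x p y q ∧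
        (∀ t, x (t + ℓ) = x t + m) ∧ ∀ t, y (t + ℓ) = y t + n := by
  have harc : ∀ γ P, (liouvilleMetric f₁ f₂ h₁ h₂ p₁ p₂ hpos).IsUnitSpeedGeodesic γ →
      (liouvilleMetric f₁ f₂ h₁ h₂ p₁ p₂ hpos).arcLength γ P = P := fun γ P h => by
    simp [TorusMetric.arcLength, h.unit_speed]
  constructor
  · rintro ⟨γ, P, hP, hγ, hper, rfl⟩
    rw [harc γ P hγ]
    refine ⟨hP, _, _, _, _, hamiltonOrbit_of_isUnitSpeedGeodesic h₁ h₂ p₁ p₂ hpos hγ, fun t => ?_,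
      fun t => ?_⟩
    · simp [hper t]
    · simp [hper t]
  · rintro ⟨hℓ, x, p, y, q, h, hx, hy⟩
    have hγ := h.isUnitSpeedGeodesic h₁ h₂ p₁ p₂ hpos
    refine ⟨_, ℓ, hℓ, hγ, fun t => ?_, (harc _ ℓ hγ).symm⟩
    rw [hx, hy]
    ext i
    fin_cases i <;> simp

end

/-! ### Separation of variables -/

/-- The new time `τ`, with `τ' = 1/V`, cancels the denominators of the Hamiltonian equations. Its
inverse `θ` satisfies `θ' = V ∘ θ = p² + q²`, so the action over one new period is the old period
`ℓ`. -/
theorem HamiltonOrbit.mem_separatedSpectrum {u w x p y q : ℝ → ℝ} {K : ℝ} {m n : ℤ} {ℓ : ℝ}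
    (h : HamiltonOrbit u w x p y q) (cu : Continuous u) (cw : Continuous w)
    (hpos : ∀ ξ η, 0 < u ξ + w η) (hK : ∀ ξ η, u ξ + w η ≤ K) (pu : Function.Periodic u 1)
    (pw : Function.Periodic w 1) (hℓ : 0 < ℓ) (hm : ∀ t, x (t + ℓ) = x t + m)
    (hn : ∀ t, y (t + ℓ) = y t + n) : ℓ ∈ separatedSpectrum u w m n := by
  have cx : Continuous x := continuous_iff_continuousAt.2 fun t => (h.hasDerivAt_x t).continuousAt
  have cy : Continuous y := continuous_iff_continuousAt.2 fun t => (h.hasDerivAt_y t).continuousAt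
  set V : ℝ → ℝ := fun t => u (x t) + w (y t) with hV
  have hVpos : ∀ t, 0 < V t := fun t => hpos _ _
  have cV : Continuous V := (cu.comp cx).add (cw.comp cy)
  have hKpos : 0 < K := (hpos 0 0).trans_le (hK 0 0)
  have cVi : Continuous fun t => (V t)⁻¹ := cV.inv₀ fun t => (hVpos t).ne'
  have hVper : Function.Periodic V ℓ := fun t => by
    have e1 : u (x t + m) = u (x t) := by simpa using pu.int_mul m (x t)
    have e2 : w (y t + n) = w (y t) := by simpa using pw.int_mul n (y t)
    simp only [hV, hm, hn, e1, e2]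
  -- the new time and its inverse
  let τ : ℝ → ℝ := fun t => ∫ s in (0 : ℝ)..t, (V s)⁻¹
  have hτ : ∀ t, HasDerivAt τ (V t)⁻¹ t := fun t =>
    intervalIntegral.integral_hasDerivAt_right (cVi.intervalIntegrable _ _)
      (cVi.stronglyMeasurableAtFilter _ _) cVi.continuousAt
  have hmono : StrictMono τ := strictMono_of_deriv_pos fun t => by
    rw [(hτ t).deriv]; exact inv_pos.2 (hVpos t)
  have cτ : Continuous τ := continuous_iff_continuousAt.2 fun t => (hτ t).continuousAt
  have hτlip : ∀ s t, s ≤ t → (t - s) * K⁻¹ ≤ τ t - τ s := fun s t hst => by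
    have := Convex.mul_sub_le_image_sub_of_le_deriv (D := univ) convex_univ (f := τ) cτ.continuousOn
      (fun t _ => (hτ t).differentiableAt.differentiableWithinAt) (C := K⁻¹)
      (fun t _ => by rw [(hτ t).deriv]; exact inv_anti₀ (hVpos t) (hK _ _)) s (mem_univ _) t
      (mem_univ _) hst
    rwa [mul_comm] at this
  have hτ0 : τ 0 = 0 := by simp [τ]
  have hsurj : Function.Surjective τ := by
    refine cτ.surjective ?_ ?_
    · refine tendsto_atTop_mono' atTop (f₁ := fun t => t * K⁻¹) ?_
        (tendsto_id.atTop_mul_const (inv_pos.2 hKpos))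
      filter_upwards [eventually_ge_atTop 0] with t ht
      have := hτlip 0 t ht
      rwa [sub_zero, hτ0, sub_zero] at this
    · refine tendsto_atBot_mono' atBot (f₁ := fun t => t * K⁻¹) ?_
        (tendsto_id.atBot_mul_const (inv_pos.2 hKpos))
      filter_upwards [eventually_le_atBot 0] with t ht
      have := hτlip t 0 ht
      rw [hτ0] at this
      linarith
  let e : ℝ ≃o ℝ := hmono.orderIsoOfSurjective τ hsurj
  let θ : ℝ → ℝ := e.symm
  have hτθ : ∀ s, τ (θ s) = s := fun s => e.apply_symm_apply s
  have hθτ : ∀ t, θ (τ t) = t := fun t => e.symm_apply_apply t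
  have cθ : Continuous θ := e.symm.continuous
  have hθ : ∀ s, HasDerivAt θ (V (θ s)) s := fun s => by
    have := HasDerivAt.of_local_left_inverse (f := τ) (g := θ) (f' := (V (θ s))⁻¹) (a := s)
      cθ.continuousAt (hτ (θ s)) (inv_ne_zero (hVpos _).ne') (Eventually.of_forall hτθ)
    rwa [inv_inv] at this
  have hτadd : ∀ t, τ (t + ℓ) = τ t + τ ℓ := fun t => by
    have hper : Function.Periodic (fun t => (V t)⁻¹) ℓ := fun t => by
      change (V (t + ℓ))⁻¹ = (V t)⁻¹
      rw [hVper]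
    have h1 := hper.intervalIntegral_add_eq t 0
    rw [zero_add] at h1
    simp only [τ]
    rw [← h1, intervalIntegral.integral_add_adjacent_intervals (cVi.intervalIntegrable _ _)
      (cVi.intervalIntegrable _ _)]
  have hθadd : ∀ s, θ (s + τ ℓ) = θ s + ℓ := fun s => by
    rw [← hθτ (θ s + ℓ), hτadd, hτθ]
  have hQ : 0 < τ ℓ := hτ0 ▸ hmono hℓ
  refine ⟨x ∘ θ, p ∘ θ, y ∘ θ, q ∘ θ, τ ℓ, hQ, ⟨fun s => ?_, fun s => ?_⟩,
    ⟨fun s => ?_, fun s => ?_⟩, fun s => h.energy _, fun s => ?_, fun s => ?_, ?_⟩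
  · exact ((h.hasDerivAt_x (θ s)).comp s (hθ s)).congr_deriv (div_mul_cancel₀ _ (hVpos _).ne')
  · exact ((h.hasDerivAt_p (θ s)).comp s (hθ s)).congr_deriv (div_mul_cancel₀ _ (hVpos _).ne')
  · exact ((h.hasDerivAt_y (θ s)).comp s (hθ s)).congr_deriv (div_mul_cancel₀ _ (hVpos _).ne')
  · exact ((h.hasDerivAt_q (θ s)).comp s (hθ s)).congr_deriv (div_mul_cancel₀ _ (hVpos _).ne')
  · simp only [Function.comp, hθadd, hm]
  · simp only [Function.comp, hθadd, hn]
  · have : ∀ s, (p ∘ θ) s ^ 2 + (q ∘ θ) s ^ 2 = V (θ s) := fun s => h.energy _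
    simp only [this]
    rw [intervalIntegral.integral_eq_sub_of_hasDerivAt (fun s _ => hθ s)
      ((cV.comp cθ).intervalIntegrable _ _), hθτ, ← hτ0, hθτ, sub_zero]

/-! ### The topology of `C^r(ℝ/ℤ)` -/

/-- Cauchy estimates on the real axis for functions with a bounded extension to a strip. -/
theorem exists_iteratedDeriv_bound_of_strip (k : ℕ) : ∀ ρ : ℝ, 0 < ρ → ∃ M, 0 < M ∧
    ∀ (f : ℝ → ℝ) (C : ℝ) (F : ℂ → ℂ), DifferentiableOn ℂ F {z | |z.im| < ρ} →
      (∀ x : ℝ, F x = (f x : ℂ)) → (∀ z : ℂ, |z.im| < ρ → ‖F z‖ ≤ C) →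
      ∀ x, |iteratedDeriv k f x| ≤ M * C := by
  induction k with
  | zero =>
    intro ρ hρ
    refine ⟨1, one_pos, fun f C F _ hf hC x => ?_⟩
    have := hC x (by simpa using hρ)
    rw [hf, Complex.norm_real] at this
    simpa using this
  | succ k ih =>
    intro ρ hρ
    -- Each derivative costs half of the strip: discs of radius `ρ / 2` around points of the half
    -- strip stay in the full one.
    obtain ⟨M, hM, h⟩ := ih (ρ / 2) (by positivity)
    refine ⟨M / (ρ / 2), by positivity, fun f C F hF hf hC x => ?_⟩
    have hopen : IsOpen {z : ℂ | |z.im| < ρ} :=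
      isOpen_lt (continuous_abs.comp Complex.continuous_im) continuous_const
    have hder : ∀ x : ℝ, deriv F x = ((deriv f x : ℝ) : ℂ) := fun x => by
      have hd : HasDerivAt F (deriv F x) (x : ℂ) :=
        (hF.differentiableAt (hopen.mem_nhds (by simpa using hρ))).hasDerivAt
      have h1 : HasDerivAt f (deriv F x).re x := by
        have := hd.real_of_complex
        simpa [hf] using this
      have h2 := hd.comp_ofReal
      simp only [hf] at h2
      rw [h1.deriv]
      exact h2.unique h1.ofReal_comp
    have hball : ∀ z : ℂ, |z.im| < ρ / 2 → Metric.closedBall z (ρ / 2) ⊆ {z : ℂ | |z.im| < ρ} := by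
      intro z hz y hy
      have h1 : |(y - z).im| ≤ ρ / 2 := (Complex.abs_im_le_norm _).trans (by
        rwa [← dist_eq_norm])
      have h2 : |y.im| ≤ |(y - z).im| + |z.im| := by
        have := abs_add_le (y - z).im z.im
        simpa using this
      simp only [mem_ofPred_eq]
      linarith
    rw [iteratedDeriv_succ', div_mul_eq_mul_div, mul_div_assoc]
    refine h (deriv f) (C / (ρ / 2)) (deriv F) ?_ hder (fun z hz => ?_) x
    · exact (hF.deriv hopen).mono fun z hz => by
        simp only [mem_ofPred_eq] at hz ⊢
        linarith
    · refine Complex.norm_deriv_le_of_forall_mem_sphere_norm_le (by positivity) ?_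
        fun y hy => hC y (hball z hz (Metric.sphere_subset_closedBall hy))
      refine DifferentiableOn.diffContOnCl ?_
      rw [closure_ball _ (by positivity)]
      exact hF.mono (hball z hz)

namespace CircleFun

variable {r : WithTop ℕ∞}

theorem periodic_iteratedDeriv (f : CircleFun r) (k : ℕ) :
    Function.Periodic (iteratedDeriv k f) 1 := by
  induction k with
  | zero => simpa using f.2.2
  | succ k ih => rw [iteratedDeriv_succ]; exact ih.deriv_periodic

theorem exists_abs_iteratedDeriv_le (f : CircleFun r) {k : ℕ} (hk : (k : WithTop ℕ∞) ≤ r) :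
    ∃ C, ∀ x, |iteratedDeriv k f x| ≤ C :=
  (f.periodic_iteratedDeriv k).exists_abs_le (f.2.1.continuous_iteratedDeriv k hk)

theorem iteratedDeriv_add_smul (f h : CircleFun r) {k : ℕ} (hk : (k : WithTop ℕ∞) ≤ r) (s x : ℝ) :
    iteratedDeriv k (f + s • h : CircleFun r) x = iteratedDeriv k f x + s * iteratedDeriv k h x := by
  have key : ∀ f h : ℝ → ℝ, ContDiff ℝ r f → ContDiff ℝ r h →
      iteratedDeriv k (f + s • h) x = iteratedDeriv k f x + s * iteratedDeriv k h x := by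
    intro f h hf hh
    rw [iteratedDeriv_add (g := s • h) (hf.of_le hk).contDiffAt ((hh.of_le hk).const_smul s).contDiffAt,
      iteratedDeriv_const_smul_field, smul_eq_mul]
  exact key f h f.2.1 h.2.1

/-- The `k`-th derivative as a linear map to the bounded continuous functions. -/
def derivBCF (k : ℕ) : CircleFun ω →ₗ[ℝ] BoundedContinuousFunction ℝ ℝ where
  toFun f := BoundedContinuousFunction.ofNormedAddCommGroup (iteratedDeriv k f)
    (f.2.1.continuous_iteratedDeriv k le_top) _ (f.exists_abs_iteratedDeriv_le le_top).choose_spec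
  map_add' f g := by
    ext x
    have := iteratedDeriv_add_smul f g (k := k) le_top 1 x
    rw [one_smul, one_mul] at this
    exact this
  map_smul' c f := by
    ext x
    exact iteratedDeriv_const_smul_field c (f : ℝ → ℝ)

/-- The induced topology is itself one of the competing locally convex topologies, the continuity on
each strip space being the Cauchy estimate. -/
theorem analyticTopology_le_induced (k : ℕ) :
    analyticTopology ≤ TopologicalSpace.induced (derivBCF k) inferInstance := by
  refine sInf_le ⟨topologicalAddGroup_induced _, continuousSMul_induced _,
    LocallyConvexSpace.induced _, fun ρ hρ U hU => ?_⟩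
  rw [nhds_induced, map_zero] at hU
  obtain ⟨W, hW, hWU⟩ := mem_comap.1 hU
  obtain ⟨ε, hε, hεW⟩ := Metric.mem_nhds_iff.1 hW
  obtain ⟨M, hM, hb⟩ := exists_iteratedDeriv_bound_of_strip k ρ hρ
  refine ⟨ε / 2 / M, by positivity, fun f ⟨F, hF, hf, hC⟩ => hWU (hεW ?_)⟩
  rw [Metric.mem_ball, dist_zero_right]
  refine lt_of_le_of_lt ((BoundedContinuousFunction.norm_le (C := ε / 2) (by positivity)).2
    fun x => ?_) (by linarith)
  have := hb f _ F hF hf hC x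
  rwa [mul_div_cancel₀ _ hM.ne'] at this

theorem tendstoUniformly_iteratedDeriv (f : CircleFun r) {k : ℕ} (hk : (k : WithTop ℕ∞) ≤ r) :
    TendstoUniformly (fun g : CircleFun r => iteratedDeriv k g) (iteratedDeriv k f) (𝓝 f) := by
  induction r using WithTop.recTopCoe with
  | top =>
    have h1 : @Continuous _ _ analyticTopology _ (derivBCF k) :=
      continuous_iff_le_induced.2 (analyticTopology_le_induced k)
    exact BoundedContinuousFunction.tendsto_iff_tendstoUniformly.1
      (@Continuous.tendsto _ _ analyticTopology _ _ h1 f)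
  | coe r =>
    have h1 : @Continuous _ _ (crTopology r) _
        (fun f : CircleFun r => UniformFun.ofFun (iteratedDeriv k f)) :=
      continuous_iff_le_induced.2 (iInf₂_le k hk)
    exact UniformFun.tendsto_iff_tendstoUniformly.1
      (@Continuous.tendsto _ _ (crTopology r) _ _ h1 f)

/-- In the analytic case continuity into an infimum of topologies is continuity into each of them,
and each is a vector space topology. -/
theorem continuous_add_smul (f h : CircleFun r) : Continuous fun s : ℝ => f + s • h := by
  induction r using WithTop.recTopCoe with
  | top =>
    refine continuous_sInf_rng.2 fun t ht => ?_
    let := t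
    have := ht.1
    have := ht.2.1
    exact continuous_const.add (continuous_id.smul continuous_const)
  | coe r =>
    refine continuous_iInf_rng.2 fun k => continuous_iInf_rng.2 fun hk =>
      continuous_induced_rng.2 (continuous_iff_continuousAt.2 fun s₀ => ?_)
    refine UniformFun.tendsto_iff_tendstoUniformly.2 (Metric.tendstoUniformly_iff.2 fun ε hε => ?_)
    obtain ⟨C, hC⟩ := h.exists_abs_iteratedDeriv_le hk
    have hC0 : 0 ≤ C := (abs_nonneg _).trans (hC 0)
    filter_upwards [Metric.ball_mem_nhds s₀ (show 0 < ε / (C + 1) by positivity)] with s hs x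
    change dist (iteratedDeriv k (f + s₀ • h : CircleFun r) x)
      (iteratedDeriv k (f + s • h : CircleFun r) x) < ε
    rw [iteratedDeriv_add_smul f h hk, iteratedDeriv_add_smul f h hk, dist_add_left, Real.dist_eq,
      ← sub_mul, abs_mul]
    rw [Metric.mem_ball, Real.dist_eq, abs_sub_comm, lt_div_iff₀ (by positivity)] at hs
    have := mul_le_mul_of_nonneg_left (hC x) (abs_nonneg (s₀ - s))
    linarith [abs_nonneg (s₀ - s)]

end CircleFun

/-! ### Limits of geodesics -/

theorem abs_sub_le_of_abs_hasDerivAt_le {f g : ℝ → ℝ} {C : ℝ} (h : ∀ t, HasDerivAt f (g t) t)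
    (hC : ∀ t, |g t| ≤ C) (s t : ℝ) : |f t - f s| ≤ C * |t - s| := by
  simpa using Convex.norm_image_sub_le_of_norm_hasDerivWithin_le (𝕜 := ℝ) (f := f) (C := C)
    (s := univ) (x := s) (y := t) (fun z _ => (h z).hasDerivWithinAt) (fun z _ => hC z)
    convex_univ (mem_univ _) (mem_univ _)

theorem abs_taylor_le_of_lipschitz {f g : ℝ → ℝ} {C : ℝ} (h : ∀ t, HasDerivAt f (g t) t)
    (hC : ∀ s t, |g t - g s| ≤ C * |t - s|) (s t : ℝ) :
    |f t - f s - g s * (t - s)| ≤ C * (t - s) ^ 2 := by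
  have hC0 : 0 ≤ C := by
    have := (abs_nonneg _).trans (hC 0 1)
    simpa using this
  have := Convex.norm_image_sub_le_of_norm_hasDerivWithin_le (𝕜 := ℝ)
    (f := fun z => f z - g s * z) (f' := fun z => g z - g s)
    (C := C * |t - s|) (s := uIcc s t) (x := s) (y := t)
    (fun z _ => by
      simpa using ((h z).fun_sub ((hasDerivAt_id z).const_mul (g s))).hasDerivWithinAt)
    (fun z hz => (hC s z).trans (mul_le_mul_of_nonneg_left (abs_sub_left_of_mem_uIcc hz) hC0))
    (convex_uIcc s t) left_mem_uIcc right_mem_uIcc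
  have e : f t - f s - g s * (t - s) = f t - g s * t - (f s - g s * s) := by ring
  rw [e]
  refine this.trans (le_of_eq ?_)
  rw [Real.norm_eq_abs, mul_assoc, ← sq, sq_abs]

theorem hasDerivAt_of_abs_taylor_le {f : ℝ → ℝ} {a C s : ℝ}
    (h : ∀ t, |f t - f s - a * (t - s)| ≤ C * (t - s) ^ 2) : HasDerivAt f a s := by
  rw [hasDerivAt_iff_isLittleO, Asymptotics.isLittleO_iff]
  intro c hc
  filter_upwards [Metric.ball_mem_nhds s (show 0 < c / (|C| + 1) by positivity)] with t ht
  rw [Metric.mem_ball, Real.dist_eq, lt_div_iff₀ (by positivity)] at ht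
  rw [smul_eq_mul, mul_comm (t - s), Real.norm_eq_abs, Real.norm_eq_abs]
  refine (h t).trans ?_
  rw [← sq_abs (t - s), sq, ← mul_assoc]
  refine mul_le_mul_of_nonneg_right ?_ (abs_nonneg _)
  have h1 := mul_le_mul_of_nonneg_right (le_abs_self C) (abs_nonneg (t - s))
  linarith [abs_nonneg (t - s)]

/-- Pointwise limits of functions with uniform second order Taylor estimates. -/
theorem hasDerivAt_of_tendsto {ι : Type*} {l : Filter ι} [l.NeBot] {f g : ι → ℝ → ℝ} {f₀ g₀ : ℝ → ℝ}
    {C : ℝ} (hf : ∀ t, Tendsto (fun i => f i t) l (𝓝 (f₀ t)))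
    (hg : ∀ t, Tendsto (fun i => g i t) l (𝓝 (g₀ t)))
    (h : ∀ᶠ i in l, ∀ s t, |f i t - f i s - g i s * (t - s)| ≤ C * (t - s) ^ 2) (s : ℝ) :
    HasDerivAt f₀ (g₀ s) s := by
  refine hasDerivAt_of_abs_taylor_le (C := C) fun t => ?_
  refine le_of_tendsto ((((hf t).sub (hf s)).sub ((hg s).mul_const (t - s))).abs) ?_
  filter_upwards [h] with i hi using hi s t

theorem abs_div_sub_div_le {a b V W A L M δ d : ℝ} (hδ : 0 < δ) (hA : |a| ≤ A) (hV : δ ≤ V)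
    (hW : δ ≤ W) (hab : |a - b| ≤ L * d) (hVW : |V - W| ≤ M * d) :
    |a / V - b / W| ≤ (L / δ + A * M / δ ^ 2) * d := by
  have pV : 0 < V := hδ.trans_le hV
  have pW : 0 < W := hδ.trans_le hW
  have hA0 : 0 ≤ A := (abs_nonneg _).trans hA
  have e : a / V - b / W = (a - b) / W + -(a * (V - W) / (V * W)) := by
    field_simp
    ring
  have h1 : |(a - b) / W| ≤ L * d / δ := by
    rw [abs_div, abs_of_pos pW]
    have := (abs_nonneg _).trans hab
    gcongr
  have h2 : |a * (V - W) / (V * W)| ≤ A * (M * d) / δ ^ 2 := by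
    rw [abs_div, abs_mul, abs_of_pos (mul_pos pV pW), sq]
    have := (abs_nonneg _).trans hVW
    gcongr
  rw [e]
  refine (abs_add_le _ _).trans ?_
  rw [abs_neg]
  refine (add_le_add h1 h2).trans (le_of_eq ?_)
  ring

theorem HamiltonOrbit.swap {u w x p y q : ℝ → ℝ} (h : HamiltonOrbit u w x p y q) :
    HamiltonOrbit w u y q x p := by
  refine ⟨fun t => ?_, fun t => ?_, fun t => ?_, fun t => ?_, fun t => ?_⟩
  · rw [add_comm]; exact h.hasDerivAt_y t
  · rw [add_comm]; exact h.hasDerivAt_q t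
  · rw [add_comm]; exact h.hasDerivAt_x t
  · rw [add_comm]; exact h.hasDerivAt_p t
  · rw [add_comm, h.energy t, add_comm]

theorem HamiltonOrbit.abs_momentum_le {u w x p y q : ℝ → ℝ} {K : ℝ} (h : HamiltonOrbit u w x p y q)
    (hu : C2Bound u K) (hw : C2Bound w K) (t : ℝ) : |p t| ≤ 2 * K + 1 := by
  have h1 := (abs_le.1 (hu.abs_le (x t))).2
  have h2 := (abs_le.1 (hw.abs_le (y t))).2
  have h3 := hu.nonneg
  refine abs_le_of_sq_le_sq ?_ (by positivity)
  nlinarith [h.energy t, sq_nonneg (q t)]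

theorem HamiltonOrbit.abs_sub_le {u w x p y q : ℝ → ℝ} {K δ : ℝ} (h : HamiltonOrbit u w x p y q)
    (hu : C2Bound u K) (hw : C2Bound w K) (hδ : 0 < δ) (hV : ∀ ξ η, δ ≤ u ξ + w η) (s t : ℝ) :
    |x t - x s| ≤ (2 * K + 1) / δ * |t - s| := by
  refine abs_sub_le_of_abs_hasDerivAt_le h.hasDerivAt_x (fun t => ?_) s t
  rw [abs_div, abs_of_pos (hδ.trans_le (hV _ _))]
  have := hu.nonneg
  gcongr
  · exact h.abs_momentum_le hu hw t
  · exact hV _ _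

/-- The right-hand sides of the equations are Lipschitz in time, with the constants `C₁` and `C₂`
depending only on `K` and `δ`. This uniformity lets the equations pass to pointwise limits. -/
theorem HamiltonOrbit.exists_taylor_bound {K δ : ℝ} (hδ : 0 < δ) : ∃ C, ∀ u w x p y q : ℝ → ℝ,
    HamiltonOrbit u w x p y q → C2Bound u K → C2Bound w K → (∀ ξ η, δ ≤ u ξ + w η) →
    (∀ s t, |x t - x s - p s / (u (x s) + w (y s)) * (t - s)| ≤ C * (t - s) ^ 2) ∧
    (∀ s t, |p t - p s - deriv u (x s) / 2 / (u (x s) + w (y s)) * (t - s)| ≤ C * (t - s) ^ 2) := by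
  set S := (2 * K + 1) / δ with hS
  set C₁ := (K / δ) / δ + (2 * K + 1) * (2 * K * S) / δ ^ 2 with hC₁
  set C₂ := (K * S) / δ + K * (2 * K * S) / δ ^ 2 with hC₂
  refine ⟨max C₁ C₂, fun u w x p y q h hu hw hV => ?_⟩
  have hK := hu.nonneg
  have hx := h.abs_sub_le hu hw hδ hV
  have hy := h.swap.abs_sub_le hw hu hδ (fun ξ η => by rw [add_comm]; exact hV η ξ)
  have hp : ∀ s t, |p t - p s| ≤ K / δ * |t - s| := fun s t => by
    refine abs_sub_le_of_abs_hasDerivAt_le h.hasDerivAt_p (fun t => ?_) s t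
    rw [abs_div, abs_of_pos (hδ.trans_le (hV _ _)), abs_div, abs_two]
    gcongr
    · linarith [hu.abs_deriv_le (x t), abs_nonneg (deriv u (x t))]
    · exact hV _ _
  have hVl : ∀ s t, |u (x t) + w (y t) - (u (x s) + w (y s))| ≤ 2 * K * S * |t - s| := fun s t => by
    have h1 := (hu.abs_sub_le (x t) (x s)).trans (mul_le_mul_of_nonneg_left (hx s t) hK)
    have h2 := (hw.abs_sub_le (y t) (y s)).trans (mul_le_mul_of_nonneg_left (hy s t) hK)
    have h3 := abs_add_le (u (x t) - u (x s)) (w (y t) - w (y s))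
    rw [show u (x t) + w (y t) - (u (x s) + w (y s)) = u (x t) - u (x s) + (w (y t) - w (y s)) by ring]
    rw [← hS] at h1 h2
    linarith
  constructor
  · refine fun s t => (abs_taylor_le_of_lipschitz h.hasDerivAt_x (C := C₁) (fun s t => ?_) s t).trans
      (mul_le_mul_of_nonneg_right (le_max_left _ _) (sq_nonneg _))
    exact abs_div_sub_div_le hδ (h.abs_momentum_le hu hw t) (hV _ _) (hV _ _) (hp s t) (hVl s t)
  · refine fun s t => (abs_taylor_le_of_lipschitz h.hasDerivAt_p (C := C₂) (fun s t => ?_) s t).trans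
      (mul_le_mul_of_nonneg_right (le_max_right _ _) (sq_nonneg _))
    refine abs_div_sub_div_le hδ ?_ (hV _ _) (hV _ _) ?_ (hVl s t)
    · rw [abs_div, abs_two]
      linarith [hu.abs_deriv_le (x t), abs_nonneg (deriv u (x t))]
    · have h1 := (hu.abs_deriv_sub_le (x t) (x s)).trans (mul_le_mul_of_nonneg_left (hx s t) hK)
      rw [← sub_div, abs_div, abs_two]
      rw [← hS] at h1
      linarith [abs_nonneg (deriv u (x t) - deriv u (x s))]

theorem HamiltonOrbit.add_int {u w x p y q : ℝ → ℝ} (h : HamiltonOrbit u w x p y q)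
    (pu : Function.Periodic u 1) (pw : Function.Periodic w 1) (a b : ℤ) :
    HamiltonOrbit u w (fun t => x t + a) p (fun t => y t + b) q := by
  have e1 : ∀ t, u (x t + a) = u (x t) := fun t => by simpa using pu.int_mul a (x t)
  have e2 : ∀ t, w (y t + b) = w (y t) := fun t => by simpa using pw.int_mul b (y t)
  have e3 : ∀ t, deriv u (x t + a) = deriv u (x t) := fun t => by
    simpa using pu.deriv_periodic.int_mul a (x t)
  have e4 : ∀ t, deriv w (y t + b) = deriv w (y t) := fun t => by
    simpa using pw.deriv_periodic.int_mul b (y t)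
  refine ⟨fun t => ?_, fun t => ?_, fun t => ?_, fun t => ?_, fun t => ?_⟩
  · rw [e1, e2]; exact (h.hasDerivAt_x t).add_const _
  · rw [e1, e2, e3]; exact h.hasDerivAt_p t
  · rw [e1, e2]; exact (h.hasDerivAt_y t).add_const _
  · rw [e1, e2, e4]; exact h.hasDerivAt_q t
  · rw [e1, e2]; exact h.energy t

theorem Ultrafilter.exists_tendsto_of_abs_le {ι : Type*} (F : Ultrafilter ι) {f : ι → ℝ} {C : ℝ}
    (h : ∀ᶠ i in (F : Filter ι), |f i| ≤ C) : ∃ a, Tendsto f F (𝓝 a) := by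
  obtain ⟨a, -, ha⟩ := (isCompact_Icc (a := -C) (b := C)).ultrafilter_le_nhds (F.map f) (by
    rw [le_principal_iff]
    exact h.mono fun i hi => abs_le.1 hi)
  exact ⟨a, ha⟩

/-- Limits of closed geodesics along an ultrafilter. -/
theorem exists_hamiltonOrbit_of_tendsto {ι : Type*} (F : Ultrafilter ι) {U W : ι → ℝ → ℝ}
    {u w : ℝ → ℝ} {K δ : ℝ} (hδ : 0 < δ) (hU : TendstoUniformly U u F) (hW : TendstoUniformly W w F)
    (hU' : TendstoUniformly (fun i => deriv (U i)) (deriv u) F)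
    (hW' : TendstoUniformly (fun i => deriv (W i)) (deriv w) F)
    (cu : Continuous u) (cw : Continuous w) (cu' : Continuous (deriv u)) (cw' : Continuous (deriv w))
    (hpos : ∀ ξ η, 0 < u ξ + w η)
    (hb : ∀ᶠ i in (F : Filter ι), C2Bound (U i) K ∧ C2Bound (W i) K ∧ ∀ ξ η, δ ≤ U i ξ + W i η)
    (pU : ∀ i, Function.Periodic (U i) 1) (pW : ∀ i, Function.Periodic (W i) 1) {ℓ : ι → ℝ} {ℓ₀ : ℝ}
    (hℓ : Tendsto ℓ F (𝓝 ℓ₀)) {m n : ℤ}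
    (h : ∀ᶠ i in (F : Filter ι), ∃ x p y q, HamiltonOrbit (U i) (W i) x p y q ∧
      (∀ t, x (t + ℓ i) = x t + m) ∧ ∀ t, y (t + ℓ i) = y t + n) :
    ∃ x p y q, HamiltonOrbit u w x p y q ∧ (∀ t, x (t + ℓ₀) = x t + m) ∧
      ∀ t, y (t + ℓ₀) = y t + n := by
  have hnorm : ∀ᶠ i in (F : Filter ι), ∃ z : (ℝ → ℝ) × (ℝ → ℝ) × (ℝ → ℝ) × (ℝ → ℝ),
      HamiltonOrbit (U i) (W i) z.1 z.2.1 z.2.2.1 z.2.2.2 ∧ |z.1 0| ≤ 1 ∧ |z.2.2.1 0| ≤ 1 ∧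
      (∀ t, z.1 (t + ℓ i) = z.1 t + m) ∧ ∀ t, z.2.2.1 (t + ℓ i) = z.2.2.1 t + n := by
    filter_upwards [h] with i hi
    obtain ⟨x, p, y, q, ho, hx, hy⟩ := hi
    have hfr : ∀ a : ℝ, |a + (-⌊a⌋ : ℤ)| ≤ 1 := fun a => by
      push_cast
      rw [← sub_eq_add_neg, Int.self_sub_floor, abs_of_nonneg (Int.fract_nonneg a)]
      exact (Int.fract_lt_one a).le
    refine ⟨(_, _, _, _), ho.add_int (pU i) (pW i) (-⌊x 0⌋) (-⌊y 0⌋), hfr _, hfr _, fun t => ?_,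
      fun t => ?_⟩
    · simp only [hx]; ring
    · simp only [hy]; ring
  obtain ⟨z, hz⟩ := hnorm.choice
  set S := (2 * K + 1) / δ with hS
  have hlip : ∀ᶠ i in (F : Filter ι), ∀ s t, |(z i).1 t - (z i).1 s| ≤ S * |t - s| ∧
      |(z i).2.2.1 t - (z i).2.2.1 s| ≤ S * |t - s| := by
    filter_upwards [hz, hb] with i hi hbi s t
    exact ⟨hi.1.abs_sub_le hbi.1 hbi.2.1 hδ hbi.2.2 s t,
      hi.1.swap.abs_sub_le hbi.2.1 hbi.1 hδ (fun ξ η => by rw [add_comm]; exact hbi.2.2 η ξ) s t⟩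
  -- Boundedness gives limits along the ultrafilter at all times at once, in place of an extraction
  -- of subsequences.
  have lx : ∀ t, ∃ a, Tendsto (fun i => (z i).1 t) F (𝓝 a) := fun t =>
    F.exists_tendsto_of_abs_le (C := 1 + S * |t - 0|) (by
      filter_upwards [hz, hlip] with i hi hli
      have := abs_add_le ((z i).1 t - (z i).1 0) ((z i).1 0)
      rw [sub_add_cancel] at this
      linarith [(hli 0 t).1, hi.2.1])
  have ly : ∀ t, ∃ a, Tendsto (fun i => (z i).2.2.1 t) F (𝓝 a) := fun t =>
    F.exists_tendsto_of_abs_le (C := 1 + S * |t - 0|) (by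
      filter_upwards [hz, hlip] with i hi hli
      have := abs_add_le ((z i).2.2.1 t - (z i).2.2.1 0) ((z i).2.2.1 0)
      rw [sub_add_cancel] at this
      linarith [(hli 0 t).2, hi.2.2.1])
  have lp : ∀ t, ∃ a, Tendsto (fun i => (z i).2.1 t) F (𝓝 a) := fun t =>
    F.exists_tendsto_of_abs_le (C := 2 * K + 1) (by
      filter_upwards [hz, hb] with i hi hbi using hi.1.abs_momentum_le hbi.1 hbi.2.1 t)
  have lq : ∀ t, ∃ a, Tendsto (fun i => (z i).2.2.2 t) F (𝓝 a) := fun t =>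
    F.exists_tendsto_of_abs_le (C := 2 * K + 1) (by
      filter_upwards [hz, hb] with i hi hbi using hi.1.swap.abs_momentum_le hbi.2.1 hbi.1 t)
  choose x hx using lx
  choose p hp using lp
  choose y hy using ly
  choose q hq using lq
  have hUx : ∀ t, Tendsto (fun i => U i ((z i).1 t)) F (𝓝 (u (x t))) := fun t =>
    hU.tendsto_comp cu.continuousAt (hx t)
  have hWy : ∀ t, Tendsto (fun i => W i ((z i).2.2.1 t)) F (𝓝 (w (y t))) := fun t =>
    hW.tendsto_comp cw.continuousAt (hy t)
  have hUx' : ∀ t, Tendsto (fun i => deriv (U i) ((z i).1 t)) F (𝓝 (deriv u (x t))) := fun t =>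
    hU'.tendsto_comp cu'.continuousAt (hx t)
  have hWy' : ∀ t, Tendsto (fun i => deriv (W i) ((z i).2.2.1 t)) F (𝓝 (deriv w (y t))) := fun t =>
    hW'.tendsto_comp cw'.continuousAt (hy t)
  have hV : ∀ t, Tendsto (fun i => U i ((z i).1 t) + W i ((z i).2.2.1 t)) F
      (𝓝 (u (x t) + w (y t))) := fun t => (hUx t).add (hWy t)
  have hV0 : ∀ t, u (x t) + w (y t) ≠ 0 := fun t => (hpos _ _).ne'
  obtain ⟨C, hC⟩ := HamiltonOrbit.exists_taylor_bound (K := K) hδ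
  have hT := hz.and hb
  refine ⟨x, p, y, q, ⟨fun t => ?_, fun t => ?_, fun t => ?_, fun t => ?_, fun t => ?_⟩,
    fun t => ?_, fun t => ?_⟩
  · refine hasDerivAt_of_tendsto (C := C) (g₀ := fun t => p t / (u (x t) + w (y t))) hx
      (fun t => (hp t).div (hV t) (hV0 t)) ?_ t
    filter_upwards [hT] with i hi using (hC _ _ _ _ _ _ hi.1.1 hi.2.1 hi.2.2.1 hi.2.2.2).1
  · refine hasDerivAt_of_tendsto (C := C) (g₀ := fun t => deriv u (x t) / 2 / (u (x t) + w (y t))) hp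
      (fun t => ((hUx' t).div_const 2).div (hV t) (hV0 t)) ?_ t
    filter_upwards [hT] with i hi using (hC _ _ _ _ _ _ hi.1.1 hi.2.1 hi.2.2.1 hi.2.2.2).2
  · refine hasDerivAt_of_tendsto (C := C) (g₀ := fun t => q t / (u (x t) + w (y t))) hy
      (fun t => (hq t).div (hV t) (hV0 t)) ?_ t
    filter_upwards [hT] with i hi
    have := (hC _ _ _ _ _ _ hi.1.1.swap hi.2.2.1 hi.2.1
      fun ξ η => by rw [add_comm]; exact hi.2.2.2 η ξ).1
    simp only [add_comm (W i _)] at this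
    exact this
  · refine hasDerivAt_of_tendsto (C := C) (g₀ := fun t => deriv w (y t) / 2 / (u (x t) + w (y t))) hq
      (fun t => ((hWy' t).div_const 2).div (hV t) (hV0 t)) ?_ t
    filter_upwards [hT] with i hi
    have := (hC _ _ _ _ _ _ hi.1.1.swap hi.2.2.1 hi.2.1
      fun ξ η => by rw [add_comm]; exact hi.2.2.2 η ξ).2
    simp only [add_comm (W i _)] at this
    exact this
  · refine tendsto_nhds_unique (((hp t).pow 2).add ((hq t).pow 2)) ((hV t).congr' ?_)
    filter_upwards [hz] with i hi using (hi.1.energy t).symm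
  · refine tendsto_nhds_unique (hx (t + ℓ₀)) ?_
    have h0 : Tendsto (fun i => (z i).1 (t + ℓ₀) - (z i).1 (t + ℓ i)) F (𝓝 0) := by
      refine squeeze_zero_norm' (a := fun i => S * |ℓ₀ - ℓ i|) ?_ ?_
      · filter_upwards [hlip] with i hi
        refine ((hi (t + ℓ i) (t + ℓ₀)).1).trans (le_of_eq ?_)
        rw [add_sub_add_left_eq_sub]
      · have := ((tendsto_const_nhds (x := ℓ₀)).sub hℓ).abs.const_mul S
        simpa using this
    have h1 := h0.add ((hx t).add_const (m : ℝ))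
    rw [zero_add] at h1
    refine h1.congr' ?_
    filter_upwards [hz] with i hi
    rw [hi.2.2.2.1 t]
    ring
  · refine tendsto_nhds_unique (hy (t + ℓ₀)) ?_
    have h0 : Tendsto (fun i => (z i).2.2.1 (t + ℓ₀) - (z i).2.2.1 (t + ℓ i)) F (𝓝 0) := by
      refine squeeze_zero_norm' (a := fun i => S * |ℓ₀ - ℓ i|) ?_ ?_
      · filter_upwards [hlip] with i hi
        refine ((hi (t + ℓ i) (t + ℓ₀)).2).trans (le_of_eq ?_)
        rw [add_sub_add_left_eq_sub]
      · have := ((tendsto_const_nhds (x := ℓ₀)).sub hℓ).abs.const_mul S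
        simpa using this
    have h1 := h0.add ((hy t).add_const (n : ℝ))
    rw [zero_add] at h1
    refine h1.congr' ?_
    filter_upwards [hz] with i hi
    rw [hi.2.2.2.2 t]
    ring

/-! ### Coincidences of lengths -/

/-- Near a given point only finitely many of the sets matter, and finite intersections of dense open
sets are dense in any space; no Baire property is needed. -/
theorem LocallyFinite.dense_compl_iUnion {X ι : Type*} [TopologicalSpace X] {C : ι → Set X}
    (hf : LocallyFinite C) (hc : ∀ i, IsClosed (C i)) (hd : ∀ i, Dense (C i)ᶜ) :
    Dense (⋃ i, C i)ᶜ := by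
  have hfin : ∀ I : Set ι, I.Finite → IsOpen (⋂ i ∈ I, (C i)ᶜ) ∧ Dense (⋂ i ∈ I, (C i)ᶜ) := by
    intro I hI
    induction I, hI using Set.Finite.induction_on with
    | empty => simp
    | @insert a s _ _ ih =>
      rw [biInter_insert]
      exact ⟨(hc a).isOpen_compl.inter ih.1, (hd a).inter_of_isOpen_right ih.2 ih.1⟩
  intro p
  rw [mem_closure_iff_nhds]
  intro O hO
  obtain ⟨t, ht, htf⟩ := hf p
  obtain ⟨q, hq, hqI⟩ := (mem_closure_iff_nhds.1 ((hfin _ htf).2 p)) _ (inter_mem hO ht)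
  refine ⟨q, hq.1, fun hqC => ?_⟩
  obtain ⟨i, hi⟩ := mem_iUnion.1 hqC
  exact mem_iInter₂.1 hqI i ⟨q, hi, hq.2⟩ hi

namespace LiouvillePair

variable {r : WithTop ℕ∞}

/-- The summand `1 + f₁` of the conformal factor. -/
def left (p : LiouvillePair r) : ℝ → ℝ := fun ξ => 1 + p.1.1 ξ

/-- The summand `f₂` of the conformal factor. -/
def right (p : LiouvillePair r) : ℝ → ℝ := p.1.2

theorem left_periodic (p : LiouvillePair r) : Function.Periodic p.left 1 := fun ξ =>
  congrArg (1 + ·) (p.1.1.2.2 ξ)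

theorem right_periodic (p : LiouvillePair r) : Function.Periodic p.right 1 := p.1.2.2.2

theorem left_contDiff (hr : 2 ≤ r) (p : LiouvillePair r) : ContDiff ℝ 2 p.left :=
  contDiff_const.add (p.1.1.2.1.of_le hr)

theorem right_contDiff (hr : 2 ≤ r) (p : LiouvillePair r) : ContDiff ℝ 2 p.right :=
  p.1.2.2.1.of_le hr

theorem left_add_right_pos (p : LiouvillePair r) (ξ η : ℝ) : 0 < p.left ξ + p.right η := by
  have := p.2 ξ η
  simp only [left, right]
  linarith

theorem mem_lengthSpectrum_iff (hr : 2 ≤ r) (p : LiouvillePair r) {m n : ℤ} {ℓ : ℝ} :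
    ℓ ∈ (p.metric hr).lengthSpectrum m n ↔ 0 < ℓ ∧ ∃ x p' y q,
      HamiltonOrbit p.left p.right x p' y q ∧ (∀ t, x (t + ℓ) = x t + m) ∧ ∀ t, y (t + ℓ) = y t + n :=
  mem_lengthSpectrum_liouvilleMetric_iff _ _ _ _ _

theorem lengthSpectrum_subset (hr : 2 ≤ r) (p : LiouvillePair r) (m n : ℤ) :
    (p.metric hr).lengthSpectrum m n ⊆ separatedSpectrum p.left p.right m n := by
  intro ℓ hℓ
  obtain ⟨h0, x, p', y, q, h, hx, hy⟩ := (p.mem_lengthSpectrum_iff hr).1 hℓ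
  obtain ⟨K, -, bu⟩ := exists_c2Bound (p.left_contDiff hr) p.left_periodic
  obtain ⟨K', -, bw⟩ := exists_c2Bound (p.right_contDiff hr) p.right_periodic
  exact h.mem_separatedSpectrum bu.contDiff.continuous bw.contDiff.continuous p.left_add_right_pos
    (fun ξ η => add_le_add ((le_abs_self _).trans (bu.abs_le ξ)) ((le_abs_self _).trans (bw.abs_le η)))
    p.left_periodic p.right_periodic h0 hx hy

theorem exists_left_add_right_ge (hr : 2 ≤ r) (p : LiouvillePair r) :
    ∃ δ > 0, ∀ ξ η, δ ≤ p.left ξ + p.right η := by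
  obtain ⟨y, ⟨ξ₀, rfl⟩, hy⟩ := (p.left_periodic.compact_of_continuous one_ne_zero
    (p.left_contDiff hr).continuous).exists_isLeast (range_nonempty _)
  obtain ⟨z, ⟨η₀, rfl⟩, hz⟩ := (p.right_periodic.compact_of_continuous one_ne_zero
    (p.right_contDiff hr).continuous).exists_isLeast (range_nonempty _)
  exact ⟨_, p.left_add_right_pos ξ₀ η₀, fun ξ η =>
    add_le_add (hy (mem_range_self ξ)) (hz (mem_range_self η))⟩

theorem tendstoUniformly_fst (p₀ : LiouvillePair r) {k : ℕ} (hk : (k : WithTop ℕ∞) ≤ r) :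
    TendstoUniformly (fun p : LiouvillePair r => iteratedDeriv k p.1.1) (iteratedDeriv k p₀.1.1)
      (𝓝 p₀) := fun V hV =>
  ((continuous_fst.comp continuous_subtype_val).tendsto p₀).eventually
    (p₀.1.1.tendstoUniformly_iteratedDeriv hk V hV)

theorem tendstoUniformly_snd (p₀ : LiouvillePair r) {k : ℕ} (hk : (k : WithTop ℕ∞) ≤ r) :
    TendstoUniformly (fun p : LiouvillePair r => iteratedDeriv k p.1.2) (iteratedDeriv k p₀.1.2)
      (𝓝 p₀) := fun V hV =>
  ((continuous_snd.comp continuous_subtype_val).tendsto p₀).eventually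
    (p₀.1.2.tendstoUniformly_iteratedDeriv hk V hV)

theorem deriv_left (p : LiouvillePair r) : deriv p.left = deriv p.1.1 :=
  deriv_const_add' (1 : ℝ)

theorem tendstoUniformly_left (p₀ : LiouvillePair r) :
    TendstoUniformly (fun p : LiouvillePair r => p.left) p₀.left (𝓝 p₀) := by
  have h := p₀.tendstoUniformly_fst (k := 0) (by simp)
  simp only [iteratedDeriv_zero] at h
  rw [Metric.tendstoUniformly_iff] at h ⊢
  simpa [left] using h

theorem tendstoUniformly_right (p₀ : LiouvillePair r) :
    TendstoUniformly (fun p : LiouvillePair r => p.right) p₀.right (𝓝 p₀) := by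
  have h := p₀.tendstoUniformly_snd (k := 0) (by simp)
  simp only [iteratedDeriv_zero] at h
  exact h

theorem tendstoUniformly_deriv_left (hr : 2 ≤ r) (p₀ : LiouvillePair r) :
    TendstoUniformly (fun p : LiouvillePair r => deriv p.left) (deriv p₀.left) (𝓝 p₀) := by
  have h := p₀.tendstoUniformly_fst (k := 1) (le_trans (by norm_num) hr)
  simp only [iteratedDeriv_one] at h
  simpa only [deriv_left] using h

theorem tendstoUniformly_deriv_right (hr : 2 ≤ r) (p₀ : LiouvillePair r) :
    TendstoUniformly (fun p : LiouvillePair r => deriv p.right) (deriv p₀.right) (𝓝 p₀) := by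
  have h := p₀.tendstoUniformly_snd (k := 1) (le_trans (by norm_num) hr)
  simp only [iteratedDeriv_one] at h
  exact h

theorem eventually_c2Bound {ι : Type*} {l : Filter ι} {U : ι → ℝ → ℝ} {u : ℝ → ℝ} {K : ℝ}
    (hu : C2Bound u K) (hU : ∀ i, ContDiff ℝ 2 (U i)) (h0 : TendstoUniformly U u l)
    (h1 : TendstoUniformly (fun i => deriv (U i)) (deriv u) l)
    (h2 : TendstoUniformly (fun i => deriv (deriv (U i))) (deriv (deriv u)) l) :
    ∀ᶠ i in l, C2Bound (U i) (K + 1) := by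
  have hle : ∀ {a b : ℝ}, |a| ≤ K → dist a b < 1 → |b| ≤ K + 1 := fun {a b} ha hab => by
    rw [dist_comm, Real.dist_eq] at hab
    have := abs_add_le (b - a) a
    rw [sub_add_cancel] at this
    linarith
  filter_upwards [Metric.tendstoUniformly_iff.1 h0 1 one_pos,
    Metric.tendstoUniformly_iff.1 h1 1 one_pos, Metric.tendstoUniformly_iff.1 h2 1 one_pos]
    with i a0 a1 a2
  exact ⟨hU i, fun x => hle (hu.abs_le x) (a0 x), fun x => hle (hu.abs_deriv_le x) (a1 x),
    fun x => hle (hu.abs_deriv_deriv_le x) (a2 x)⟩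

theorem iteratedDeriv_two_eq (f : ℝ → ℝ) : iteratedDeriv 2 f = deriv (deriv f) := by
  rw [iteratedDeriv_succ, iteratedDeriv_one]

/-- Uniform bounds near a pair. -/
theorem exists_eventually_bounds (hr : 2 ≤ r) (p₀ : LiouvillePair r) : ∃ K δ, 0 < δ ∧
    ∀ᶠ p in 𝓝 p₀, C2Bound p.left K ∧ C2Bound p.right K ∧ ∀ ξ η, δ ≤ p.left ξ + p.right η := by
  obtain ⟨K, -, bu⟩ := exists_c2Bound (p₀.left_contDiff hr) p₀.left_periodic
  obtain ⟨K', -, bw⟩ := exists_c2Bound (p₀.right_contDiff hr) p₀.right_periodic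
  obtain ⟨δ, hδ, hle⟩ := p₀.exists_left_add_right_ge hr
  have b1 : C2Bound p₀.left (max K K') := ⟨bu.1, fun x => (bu.2 x).trans (le_max_left _ _),
    fun x => (bu.3 x).trans (le_max_left _ _), fun x => (bu.4 x).trans (le_max_left _ _)⟩
  have b2 : C2Bound p₀.right (max K K') := ⟨bw.1, fun x => (bw.2 x).trans (le_max_right _ _),
    fun x => (bw.3 x).trans (le_max_right _ _), fun x => (bw.4 x).trans (le_max_right _ _)⟩
  have h2l := p₀.tendstoUniformly_fst (k := 2) hr
  have h2r := p₀.tendstoUniformly_snd (k := 2) hr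
  simp only [iteratedDeriv_two_eq] at h2l h2r
  simp only [← deriv_left] at h2l
  have e1 := eventually_c2Bound b1 (left_contDiff hr) p₀.tendstoUniformly_left
    (p₀.tendstoUniformly_deriv_left hr) h2l
  have e2 := eventually_c2Bound b2 (right_contDiff hr) p₀.tendstoUniformly_right
    (p₀.tendstoUniformly_deriv_right hr) h2r
  refine ⟨max K K' + 1, δ / 2, by positivity, ?_⟩
  filter_upwards [e1, e2, Metric.tendstoUniformly_iff.1 p₀.tendstoUniformly_left (δ / 4) (by positivity),
    Metric.tendstoUniformly_iff.1 p₀.tendstoUniformly_right (δ / 4) (by positivity)] with p a1 a2 a3 a4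
  refine ⟨a1, a2, fun ξ η => ?_⟩
  have c3 := a3 ξ
  have c4 := a4 η
  rw [Real.dist_eq, abs_lt] at c3 c4
  linarith [hle ξ η]

/-- The pairs for which the classes `i.1` and `i.2` share a length which is at most `T`. -/
def coincidence (hr : 2 ≤ r) (T : ℝ) (i : (ℤ × ℤ) × ℤ × ℤ) : Set (LiouvillePair r) :=
  {p | ∃ ℓ ≤ T, ℓ ∈ (p.metric hr).lengthSpectrum i.1.1 i.1.2 ∧
    ℓ ∈ (p.metric hr).lengthSpectrum i.2.1 i.2.2}

/-- Lengths in a class `(m, n)` are bounded below by a multiple of `|m|` and `|n|`. -/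
theorem abs_class_le {u w x p y q : ℝ → ℝ} {K δ ℓ : ℝ} {m n : ℤ} (h : HamiltonOrbit u w x p y q)
    (hu : C2Bound u K) (hw : C2Bound w K) (hδ : 0 < δ) (hV : ∀ ξ η, δ ≤ u ξ + w η) (hℓ : 0 < ℓ)
    (hx : ∀ t, x (t + ℓ) = x t + m) (hy : ∀ t, y (t + ℓ) = y t + n) :
    |(m : ℝ)| ≤ (2 * K + 1) / δ * ℓ ∧ |(n : ℝ)| ≤ (2 * K + 1) / δ * ℓ := by
  have h1 := h.abs_sub_le hu hw hδ hV 0 (0 + ℓ)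
  have h2 := h.swap.abs_sub_le hw hu hδ (fun ξ η => by rw [add_comm]; exact hV η ξ) 0 (0 + ℓ)
  rw [hx, add_sub_cancel_left, add_sub_cancel_left, abs_of_pos hℓ] at h1
  rw [hy, add_sub_cancel_left, add_sub_cancel_left, abs_of_pos hℓ] at h2
  exact ⟨h1, h2⟩

/-- Coordinate speeds are bounded uniformly near a pair, so a geodesic of length at most `T` can
only reach finitely many classes. -/
theorem locallyFinite_coincidence (hr : 2 ≤ r) (T : ℝ) :
    LocallyFinite (coincidence (r := r) hr T) := by
  intro p₀
  obtain ⟨K, δ, hδ, hb⟩ := p₀.exists_eventually_bounds hr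
  refine ⟨_, hb, ?_⟩
  set M := ⌊(2 * K + 1) / δ * T⌋ with hM
  refine ((((finite_Icc (-M) M).prod (finite_Icc (-M) M)).prod
    ((finite_Icc (-M) M).prod (finite_Icc (-M) M)))).subset ?_
  rintro ⟨⟨m, n⟩, m', n'⟩ ⟨p, ⟨ℓ, hℓT, h1, h2⟩, bu, bw, hV⟩
  have key : ∀ {m n : ℤ}, ℓ ∈ (p.metric hr).lengthSpectrum m n →
      m ∈ Icc (-M) M ∧ n ∈ Icc (-M) M := by
    intro m n h
    obtain ⟨h0, x, p', y, q, ho, hx, hy⟩ := (p.mem_lengthSpectrum_iff hr).1 h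
    have hS : 0 ≤ (2 * K + 1) / δ := by
      have := bu.nonneg
      positivity
    have hle := mul_le_mul_of_nonneg_left hℓT hS
    obtain ⟨a1, a2⟩ := abs_class_le ho bu bw hδ hV h0 hx hy
    have toM : ∀ k : ℤ, |(k : ℝ)| ≤ (2 * K + 1) / δ * ℓ → k ∈ Icc (-M) M := fun k hk => by
      refine abs_le.1 (Int.le_floor.2 ?_)
      rw [Int.cast_abs]
      exact hk.trans hle
    exact ⟨toM m a1, toM n a2⟩
  exact ⟨key h1, key h2⟩

/-- Closed geodesics with bounded length subconverge. The nonzero class keeps the common length away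
from zero, so that the limits are again closed geodesics. -/
theorem isClosed_coincidence (hr : 2 ≤ r) (T : ℝ) {i : (ℤ × ℤ) × ℤ × ℤ} (hi : i.1.1 ≠ 0) :
    IsClosed (coincidence (r := r) hr T i) := by
  rw [isClosed_iff_ultrafilter]
  intro p₀ F hF hmem
  obtain ⟨K, δ, hδ, hb⟩ := p₀.exists_eventually_bounds hr
  have hbF := hb.filter_mono hF
  obtain ⟨ℓ, hℓ⟩ := (show ∀ᶠ p in (F : Filter (LiouvillePair r)), ∃ ℓ : ℝ, ℓ ≤ T ∧
    ℓ ∈ (p.metric hr).lengthSpectrum i.1.1 i.1.2 ∧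
    ℓ ∈ (p.metric hr).lengthSpectrum i.2.1 i.2.2 from hmem).choice
  have hpos : ∀ᶠ p in (F : Filter (LiouvillePair r)), 0 < ℓ p := by
    filter_upwards [hℓ] with p hp using ((p.mem_lengthSpectrum_iff hr).1 hp.2.1).1
  obtain ⟨ℓ₀, hℓ₀⟩ := F.exists_tendsto_of_abs_le (f := ℓ) (C := T) (by
    filter_upwards [hℓ, hpos] with p hp h0
    rw [abs_of_pos h0]
    exact hp.1)
  have hT : ℓ₀ ≤ T := le_of_tendsto hℓ₀ (hℓ.mono fun p hp => hp.1)
  have hlow : |(i.1.1 : ℝ)| ≤ (2 * K + 1) / δ * ℓ₀ := by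
    refine ge_of_tendsto (hℓ₀.const_mul _) ?_
    filter_upwards [hℓ, hbF] with p hp hbp
    obtain ⟨h0, x, p', y, q, ho, hx, hy⟩ := (p.mem_lengthSpectrum_iff hr).1 hp.2.1
    exact (abs_class_le ho hbp.1 hbp.2.1 hδ hbp.2.2 h0 hx hy).1
  have hℓ₀0 : 0 ≤ ℓ₀ := ge_of_tendsto hℓ₀ (hpos.mono fun p hp => hp.le)
  have hℓ₀pos : 0 < ℓ₀ := by
    refine hℓ₀0.lt_of_ne fun h => ?_
    rw [← h, mul_zero] at hlow
    exact hi (by exact_mod_cast abs_nonpos_iff.1 hlow)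
  have lim : ∀ {m n : ℤ}, (∀ᶠ p in (F : Filter (LiouvillePair r)),
      ℓ p ∈ (p.metric hr).lengthSpectrum m n) → ℓ₀ ∈ (p₀.metric hr).lengthSpectrum m n := by
    intro m n h
    rw [mem_lengthSpectrum_iff]
    refine ⟨hℓ₀pos, exists_hamiltonOrbit_of_tendsto F hδ
      (fun V hV => (p₀.tendstoUniformly_left V hV).filter_mono hF)
      (fun V hV => (p₀.tendstoUniformly_right V hV).filter_mono hF)
      (fun V hV => (p₀.tendstoUniformly_deriv_left hr V hV).filter_mono hF)
      (fun V hV => (p₀.tendstoUniformly_deriv_right hr V hV).filter_mono hF)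
      (p₀.left_contDiff hr).continuous (p₀.right_contDiff hr).continuous
      ((p₀.left_contDiff hr).continuous_deriv (by norm_num))
      ((p₀.right_contDiff hr).continuous_deriv (by norm_num)) p₀.left_add_right_pos hbF
      left_periodic right_periodic hℓ₀ ?_⟩
    filter_upwards [h] with p hp using ((p.mem_lengthSpectrum_iff hr).1 hp).2
  exact ⟨ℓ₀, hT, lim (hℓ.mono fun p hp => hp.2.1), lim (hℓ.mono fun p hp => hp.2.2)⟩

/-! ### Density -/

/-- Small perturbations in a given direction stay in a given neighborhood. -/
theorem exists_perturbation (hr : 2 ≤ r) (p : LiouvillePair r) {O : Set (LiouvillePair r)}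
    (hO : O ∈ 𝓝 p) (h₁ h₂ : CircleFun r) : ∃ ε > 0, ∀ s : ℝ, |s| < ε →
      ∃ hp : ∀ x₁ x₂ : ℝ, -1 < (p.1.1 + s • h₁ : CircleFun r) x₁ + (p.1.2 + s • h₂ : CircleFun r) x₂,
        (⟨(p.1.1 + s • h₁, p.1.2 + s • h₂), hp⟩ : LiouvillePair r) ∈ O := by
  obtain ⟨O', hO', hsub⟩ := mem_nhds_subtype _ _ _ |>.1 hO
  have hc : Continuous fun s : ℝ => (p.1.1 + s • h₁, p.1.2 + s • h₂) :=
    (p.1.1.continuous_add_smul h₁).prodMk (p.1.2.continuous_add_smul h₂)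
  have hev : ∀ᶠ s in 𝓝 (0 : ℝ), (p.1.1 + s • h₁, p.1.2 + s • h₂) ∈ O' := by
    refine hc.continuousAt.eventually_mem ?_
    simpa using hO'
  obtain ⟨ε, hε, H⟩ := Metric.eventually_nhds_iff.1 hev
  obtain ⟨δ, hδ, hle⟩ := p.exists_left_add_right_ge hr
  obtain ⟨C₁, hC₁⟩ := h₁.2.2.exists_abs_le h₁.2.1.continuous
  obtain ⟨C₂, hC₂⟩ := h₂.2.2.exists_abs_le h₂.2.1.continuous
  have hC₁0 : 0 ≤ C₁ := (abs_nonneg _).trans (hC₁ 0)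
  have hC₂0 : 0 ≤ C₂ := (abs_nonneg _).trans (hC₂ 0)
  refine ⟨min ε (δ / (C₁ + C₂ + 1)), by positivity, fun s hs => ?_⟩
  have hp : ∀ x₁ x₂ : ℝ,
      -1 < (p.1.1 + s • h₁ : CircleFun r) x₁ + (p.1.2 + s • h₂ : CircleFun r) x₂ := by
    intro x₁ x₂
    change -1 < (p.1.1 x₁ + s * h₁ x₁) + (p.1.2 x₂ + s * h₂ x₂)
    have a1 := hle x₁ x₂
    simp only [left, right] at a1
    have a2 : |s| * (C₁ + C₂ + 1) < δ := by
      rw [← lt_div_iff₀ (by positivity)]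
      exact hs.trans_le (min_le_right _ _)
    have a3 : |s * h₁ x₁| ≤ |s| * C₁ := by rw [abs_mul]; gcongr; exact hC₁ x₁
    have a4 : |s * h₂ x₂| ≤ |s| * C₂ := by rw [abs_mul]; gcongr; exact hC₂ x₂
    have a5 := neg_abs_le (s * h₁ x₁)
    have a6 := neg_abs_le (s * h₂ x₂)
    linarith [abs_nonneg s]
  exact ⟨hp, hsub (H (y := s) (by rw [Real.dist_0_eq_abs]; exact hs.trans_le (min_le_left _ _)))⟩

/-- The constant functions. -/
def _root_.CircleFun.const (r : WithTop ℕ∞) (a : ℝ) : CircleFun r :=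
  ⟨fun _ => a, contDiff_const, fun _ => rfl⟩

/-- The function `cos (2πx)`. -/
def _root_.CircleFun.cos (r : WithTop ℕ∞) : CircleFun r :=
  ⟨fun x => Real.cos (2 * Real.pi * x), Real.contDiff_cos.comp (contDiff_const.mul contDiff_id),
    fun x => by
      change Real.cos (2 * Real.pi * (x + 1)) = _
      rw [mul_add, mul_one, Real.cos_add_two_pi]⟩

theorem exists_smul_cos_nonconstant (f : CircleFun r) {ε : ℝ} (hε : 0 < ε) :
    ∃ s : ℝ, |s| < ε ∧ ∃ ξ η, (f + s • CircleFun.cos r : CircleFun r) ξ ≠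
      (f + s • CircleFun.cos r : CircleFun r) η := by
  have hval : ∀ s ξ : ℝ, (f + s • CircleFun.cos r : CircleFun r) ξ =
    f ξ + s * Real.cos (2 * Real.pi * ξ) := fun s ξ => rfl
  by_cases h : f 0 = f (1 / 2)
  · refine ⟨ε / 2, by rw [abs_of_pos] <;> linarith, 0, 1 / 2, ?_⟩
    rw [hval, hval, h, show 2 * Real.pi * (1 / 2) = Real.pi by ring]
    simp
    linarith
  · exact ⟨0, by simpa using hε, 0, 1 / 2, by simpa [hval] using h⟩

/-- The perturbed summand is the one along which the oscillatory geodesic rotates. It is first made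
nonconstant by a multiple of the cosine, since dilation about its mean does nothing to a constant;
the direction `w - μ` then stays in the same regularity class. -/
theorem dense_compl_coincidence (hr : 2 ≤ r) (T : ℝ) {i : (ℤ × ℤ) × ℤ × ℤ} (hi : i.1.1 * i.1.2 ≠ 0)
    (hi' : i.2.1 * i.2.2 = 0) : Dense (coincidence (r := r) hr T i)ᶜ := by
  obtain ⟨⟨m, n⟩, m', n'⟩ := i
  have hm : m ≠ 0 := left_ne_zero_of_mul hi
  have hn : n ≠ 0 := right_ne_zero_of_mul hi
  intro p₀
  rw [mem_closure_iff_nhds]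
  intro O hO
  obtain ⟨O', hO'O, hO', hp₀⟩ := mem_nhds_iff.1 hO
  rcases mul_eq_zero.1 hi' with h0 | h0
  · simp only at h0
    subst h0
    obtain ⟨ε, hε, H⟩ := p₀.exists_perturbation hr (hO'.mem_nhds hp₀) 0 (CircleFun.cos r)
    obtain ⟨s, hs, hnc⟩ := exists_smul_cos_nonconstant p₀.1.2 hε
    obtain ⟨hp, hpO⟩ := H s hs
    set p : LiouvillePair r := ⟨(p₀.1.1 + s • 0, p₀.1.2 + s • CircleFun.cos r), hp⟩ with hpdef
    obtain ⟨μ, hμ⟩ := exists_dilate_disjoint (p.left_contDiff hr) (p.right_contDiff hr)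
      p.left_periodic p.right_periodic p.left_add_right_pos hnc hm hn n'
    obtain ⟨ε', hε', H'⟩ := p.exists_perturbation hr (hO'.mem_nhds hpO) 0
      (p.1.2 - CircleFun.const r μ)
    obtain ⟨σ, hσ, hdis⟩ := hμ ε' hε'
    obtain ⟨hq, hqO⟩ := H' σ (by rw [abs_of_nonneg hσ.1]; exact hσ.2)
    refine ⟨_, hO'O hqO, ?_⟩
    rintro ⟨ℓ, -, h1, h2⟩
    refine not_disjoint_iff.2 ⟨ℓ, ?_, ?_⟩ hdis
    · have := lengthSpectrum_subset hr _ _ _ h1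
      simp only [smul_zero, add_zero] at this
      exact this
    · have := lengthSpectrum_subset hr _ _ _ h2
      simp only [smul_zero, add_zero] at this
      exact this
  · simp only at h0
    subst h0
    obtain ⟨ε, hε, H⟩ := p₀.exists_perturbation hr (hO'.mem_nhds hp₀) (CircleFun.cos r) 0
    obtain ⟨s, hs, ξ, η, hne⟩ := exists_smul_cos_nonconstant p₀.1.1 hε
    obtain ⟨hp, hpO⟩ := H s hs
    set p : LiouvillePair r := ⟨(p₀.1.1 + s • CircleFun.cos r, p₀.1.2 + s • 0), hp⟩ with hpdef
    obtain ⟨μ, hμ⟩ := exists_dilate_disjoint (p.right_contDiff hr) (p.left_contDiff hr)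
      p.right_periodic p.left_periodic
      (fun ξ η => by rw [add_comm]; exact p.left_add_right_pos η ξ)
      ⟨ξ, η, fun h => hne (add_left_cancel h)⟩ hn hm m'
    -- The constant is `μ - 1` because the potential being dilated is `1 + f₁`.
    obtain ⟨ε', hε', H'⟩ := p.exists_perturbation hr (hO'.mem_nhds hpO)
      (p.1.1 - CircleFun.const r (μ - 1)) 0
    obtain ⟨σ, hσ, hdis⟩ := hμ ε' hε'
    obtain ⟨hq, hqO⟩ := H' σ (by rw [abs_of_nonneg hσ.1]; exact hσ.2)
    refine ⟨_, hO'O hqO, ?_⟩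
    rintro ⟨ℓ, -, h1, h2⟩
    have hleft : ∀ hq, left (r := r) ⟨(p.1.1 + σ • (p.1.1 - CircleFun.const r (μ - 1)), p.1.2), hq⟩ =
        dilate p.left μ σ := fun hq => by
      funext ζ
      change 1 + (p.1.1 ζ + σ * (p.1.1 ζ - (μ - 1))) = (1 + p.1.1 ζ) + σ * ((1 + p.1.1 ζ) - μ)
      ring
    refine not_disjoint_iff.2 ⟨ℓ, ?_, ?_⟩ hdis
    · have := lengthSpectrum_subset hr _ _ _ h1
      simp only [smul_zero, add_zero] at this
      have h3 := separatedSpectrum_swap this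
      rw [hleft] at h3
      exact h3
    · have := lengthSpectrum_subset hr _ _ _ h2
      simp only [smul_zero, add_zero] at this
      have h3 := separatedSpectrum_swap this
      rw [hleft] at h3
      exact h3

/-! ### The noncoincidence condition -/

theorem lengthSpectrum_subsingleton (hr : 2 ≤ r) (p : LiouvillePair r) {m n : ℤ} (h : m * n ≠ 0) :
    ((p.metric hr).lengthSpectrum m n).Subsingleton :=
  (separatedSpectrum_subsingleton (p.left_contDiff hr) (p.right_contDiff hr) p.left_periodic
    p.right_periodic (left_ne_zero_of_mul h) (right_ne_zero_of_mul h)).anti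
    (p.lengthSpectrum_subset hr m n)

/-- A class with `mn ≠ 0` has at most one length, so any length in it is automatically the minimum.
-/
theorem setOf_ncc_eq (hr : 2 ≤ r) (T : ℝ) :
    {p : LiouvillePair r | (p.metric hr).NCC (Icc 0 T)} =
      (⋃ i : {i : (ℤ × ℤ) × ℤ × ℤ // i.1.1 * i.1.2 ≠ 0 ∧ i.2.1 * i.2.2 = 0},
        coincidence (r := r) hr T i)ᶜ := by
  ext p
  rw [mem_compl_iff, mem_iUnion, not_exists]
  change _ = ∅ ↔ _
  rw [eq_empty_iff_forall_notMem]
  constructor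
  · rintro h ⟨⟨⟨m, n⟩, m', n'⟩, hi, hi'⟩ ⟨ℓ, hT, h1, h2⟩
    refine h ℓ ⟨⟨⟨m, n, hi, h1, fun ℓ' hℓ' => ?_⟩, m', n', hi', h2⟩,
      ((p.mem_lengthSpectrum_iff hr).1 h1).1.le, hT⟩
    exact (lengthSpectrum_subsingleton hr p hi h1 hℓ').le
  · rintro h ℓ ⟨⟨⟨m, n, hi, h1⟩, m', n', hi', h2⟩, h3⟩
    exact h ⟨((m, n), m', n'), hi, hi'⟩ ⟨ℓ, h3.2, h1.1, h2⟩

theorem isOpen_and_dense_ncc (hr : 2 ≤ r) (T : ℝ) :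
    IsOpen {p : LiouvillePair r | (p.metric hr).NCC (Icc 0 T)} ∧
      Dense {p : LiouvillePair r | (p.metric hr).NCC (Icc 0 T)} := by
  have hf : LocallyFinite fun i : {i : (ℤ × ℤ) × ℤ × ℤ // i.1.1 * i.1.2 ≠ 0 ∧ i.2.1 * i.2.2 = 0} =>
      coincidence (r := r) hr T i :=
    (locallyFinite_coincidence hr T).comp_injective Subtype.val_injective
  have hc : ∀ i : {i : (ℤ × ℤ) × ℤ × ℤ // i.1.1 * i.1.2 ≠ 0 ∧ i.2.1 * i.2.2 = 0},
      IsClosed (coincidence (r := r) hr T i) := fun i =>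
    isClosed_coincidence hr T (left_ne_zero_of_mul i.2.1)
  rw [setOf_ncc_eq]
  exact ⟨(hf.isClosed_iUnion hc).isOpen_compl, hf.dense_compl_iUnion hc fun i =>
    dense_compl_coincidence hr T i.2.1 i.2.2⟩

end LiouvillePair

end

/-- `r` ranges over the natural numbers `≥ 2`, `∞` and `ω` (analytic). -/
theorem propositionA1 (r : WithTop ℕ∞) (hr : 2 ≤ r) :
    (∀ᶠ p in residual (LiouvillePair r), (LiouvillePair.metric hr p).NCC (Set.Ici 0)) ∧
    ∀ T : ℝ, 0 ≤ T →
      IsOpen {p : LiouvillePair r | (LiouvillePair.metric hr p).NCC (Set.Icc 0 T)} ∧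
      Dense {p : LiouvillePair r | (LiouvillePair.metric hr p).NCC (Set.Icc 0 T)} := by
  refine ⟨?_, fun T _ => LiouvillePair.isOpen_and_dense_ncc hr T⟩
  have h : ∀ᶠ p in residual (LiouvillePair r), ∀ N : ℕ,
      (LiouvillePair.metric hr p).NCC (Set.Icc 0 (N : ℝ)) :=
    eventually_countable_forall.2 fun N =>
      residual_of_dense_open (LiouvillePair.isOpen_and_dense_ncc hr N).1
        (LiouvillePair.isOpen_and_dense_ncc hr N).2
  filter_upwards [h] with p hp
  refine Set.eq_empty_iff_forall_notMem.2 fun ℓ hℓ => ?_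
  obtain ⟨N, hN⟩ := exists_nat_ge ℓ
  exact Set.eq_empty_iff_forall_notMem.1 (hp N) ℓ ⟨hℓ.1, hℓ.2, hN⟩
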